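/- **Setting.** Let $1\le t\le n$ and $\ell\ge 1$ be integers, $\mathbb L=\mathbb F_q$ a finite field, $\mathbb F\subseteq\mathbb L$ a subfield, and $\iota:\{0,1,\dots,n\}\to\mathbb F$ a fixed injection, by which the integers $0,\dots,n$ are identified with elements of $\mathbb F$. For every $\lambda$ let $\mathcal K=\mathcal K^{(\lambda)}$ be a finite extension field of $\mathbb F$, $R=R^{(\lambda)}$ a finite set, and $$F=F^{(\lambda)}=(F_1,F_2):\mathcal K\times R\to\mathbb L^{2\ell+\lambda}\times\mathbb L=\mathbb L^{2\ell+\lambda+1}.$$ Elements of $\mathbb L$, $\mathcal K$, $R$ are represented by bit strings of fixed lengths, polynomial in $\lambda$ for $\mathcal K$ and $R$, and constant for $\mathbb L$. "Polynomial time" refers to families of (probabilistic) Boolean circuits of size polynomial in $\lambda$, with oracle gates where an oracle is given. A function $\varepsilon(\lambda)$ is negligible if for every $c$ one has $\varepsilon(\lambda)<\lambda^{-c}$ for all large $\lambda$. Assume that $F$ is an $\mathbb F$-key-homomorphic PRF family: it is computable in polynomial time; no polynomial-time adversary with adaptive oracle access distinguishes $F(k,\cdot)$, for uniform $k\in\mathcal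 K$, from a uniformly random function $R\to\mathbb L^{2\ell+\lambda+1}$ with non-negligible advantage; and $F(k_1+k_2,r)=F(k_1,r)+F(k_2,r)$ and $F(ck,r)=c\,F(k,r)$ for all $k,k_1,k_2\in\mathcal K$, $c\in\mathbb F$, $r\in R$. (All nonzero elements of the additive group of $\mathcal K$ have order $\operatorname{char}\mathbb F$, so element orders are bounded independently of $\lambda$.) Linear independence of keys is meant over a fixed subfield $k_0\subseteq\mathbb F$ (for instance $\mathbb F$ itself or the prime field); assume that for each $\lambda$ there exist $2\ell n$ linearly independent keys in $\mathcal K^{(\lambda)}$, so that $\mathsf{Gen}$ is defined. A *random Shamir sharing* of $s\in k$, for $k=\mathbb L$ or $\mathcal K$, is given by a uniformly random polynomial $p\in k[X]$ of degree $\le t-1$ with $p(0)=s$; the $i$-th share is $p(i)$, $1\le i\le n$ (coordinatewise for vectors). **Scheme.** - $\mathsf{Gen}(a,\alpha,\lambda)$, for $a=a_0\dots a_{\ell-1}\in\{0,1\}^\ell$ and $\alpha\in\mathbb L$: choose uniform $v_0,\dots,v_{2\ell-1}\in\mathbb L^{2\ell+\lambda}$ with Shamir shares $v_{i,j}$; put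 $\theta=\sum_{j=0}^{\ell-1}v_{2j+a_j}$; choose uniform $\alpha_0,\dots,\alpha_{2\ell-1}\in\mathbb L$ subject to $\sum_{j=0}^{\ell-1}\alpha_{2j+a_j}=\alpha$, with Shamir shares $\alpha_{i,j}$; choose a uniform linearly independent family of keys $k_{i,j}\in\mathcal K$ ($1\le i\le n$, $0\le j\le 2\ell-1$), with Shamir shares $k_{i,j,l}$ ($1\le l\le n$); put $k=\sum_{i=1}^n\sum_{j=0}^{\ell-1}k_{i,2j+a_j}$. The key share of party $i$ is $f_i=(i,(v_{i,j})_j,\theta,(\alpha_{i,j})_j,(k_{i,j})_j,(k_{i',j,i})_{i',j},k)$. - $\mathsf{Eval}(f_i,x,r)=(i,s_{i,0},s_{i,1},r,\theta,k)$ with $s_{i,0}=\sum_{j=0}^{\ell-1}\bigl(v_{i,2j+x_j}+\sum_{l=1}^nF_1(k_{l,2j+x_j,i},r)\bigr)$ and $s_{i,1}=\sum_{j=0}^{\ell-1}\bigl(\alpha_{i,2j+x_j}+\sum_{l=1}^nF_2(k_{l,2j+x_j,i},r)\bigr)$. - $\mathsf{Rec}(\{s_i:i\in T\})$ for $|T|=t$: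 let $S_0$ (with vector values) and $S_1$ be the polynomials of degree $\le t-1$ over $\mathbb L$ with $S_0(i)=s_{i,0}$ and $S_1(i)=s_{i,1}$ for $i\in T$. If $S_0(0)=\theta+F_1(k,r)$, output $S_1(0)-F_2(k,r)$; otherwise output $0$. **Theorem.** This is a $t$-out-of-$n$ computational multi-evaluation DPF scheme for point functions $\{0,1\}^\ell\to\mathbb L$, that is: 1. (Correctness) For all $\lambda$, $a$, $\alpha$, $r\in R$ and $T\subseteq[n]$ with $|T|=t$, and $(f_i)\leftarrow\mathsf{Gen}(a,\alpha,\lambda)$: $\Pr[\mathsf{Rec}(\{\mathsf{Eval}(f_i,a,r)\}_{i\in T})=\alpha]=1$. There is a negligible $\varepsilon$ such that for all these data and all $x\ne a$: $\Pr[\mathsf{Rec}(\{\mathsf{Eval}(f_i,x,r)\}_{i\in T})=0]>1-\varepsilon(\lambda)$. 2. (Perfect secrecy) For all $\lambda$, $a,b,\alpha,\beta$ and $S\subset[n]$ with $|S|<t$, the family $(f_i)_{i\in S}$ has the same distribution under $\mathsf{Gen}(a,\alpha,\lambda)$ and under $\mathsf{Gen}(b,\beta,\lambda)$. 3. (Computational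 multi-evaluation) Let $a,b\in\{0,1\}^\ell$, $\alpha,\beta\in\mathbb L$, $S\subset[n]$ with $|S|<t$, a polynomially bounded number $m$, points $x_1,\dots,x_m\in\{0,1\}^\ell\setminus\{a,b\}$ and distinct $r_1,\dots,r_m\in R$ be given for each $\lambda$, depending on $\lambda$ in an arbitrary way. Then the ensembles $$\bigl(\{f_i\}_{i\in S},\{\mathsf{Eval}(f_i,x_h,r_h)\}_{i\in[n],h\in[m]}\bigr),\quad (f_i)\leftarrow\mathsf{Gen}(a,\alpha,\lambda)\ \text{ resp. }\ (f_i)\leftarrow\mathsf{Gen}(b,\beta,\lambda),$$ are computationally indistinguishable: every polynomial-time distinguisher has negligible advantage. -/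

import Mathlib

open scoped BigOperators

noncomputable section

/-! ## Asymptotics -/

/-- `ε` is negligible: for every `c` it is eventually smaller than `1 / lam ^ c`. -/
def Negligible (ε : ℕ → ℝ) : Prop :=
  ∀ c : ℕ, ∃ N : ℕ, ∀ lam : ℕ, N < lam → ε lam < 1 / (lam : ℝ) ^ c

/-- `f` is bounded by a polynomial in the security parameter. -/
def PolyBounded (f : ℕ → ℕ) : Prop :=
  ∃ p : Polynomial ℕ, ∀ lam : ℕ, f lam ≤ p.eval lam

/-- The uniform distribution on a finite nonempty type. -/
def unif (X : Type) [Finite X] [Nonempty X] : PMF X :=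
  letI : Fintype X := Fintype.ofFinite X
  PMF.uniformOfFintype X

/-! ## Bit encodings -/

/-- An injective encoding of the elements of `X` as bit strings of one fixed length. -/
structure BitEncoding (X : Type) where
  len : ℕ
  bits : X → List Bool
  length_bits : ∀ x, (bits x).length = len
  injective : Function.Injective bits

/-- A vector over `X` is encoded by concatenating the encodings of its coordinates. -/
def BitEncoding.vecBits {X : Type} (e : BitEncoding X) {m : ℕ} (v : Fin m → X) : List Bool :=
  (List.finRange m).flatMap fun h => e.bits (v h)

/-! ## Circuits with oracle gates, and polynomial-time adversaries -/

/-- Gates of a Boolean oracle circuit. Wires are numbered in the order in which they are produced,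
starting with the input bits. An oracle gate sends the bits on the listed wires to the oracle;
all the bits of the answer become new wires. -/
inductive Gate where
  | const (b : Bool)
  | nand (i j : ℕ)
  | oracle (q : List ℕ)

/-- The new wires that a gate adds to the wires `w`. -/
def Gate.run (O : List Bool → List Bool) (w : List Bool) : Gate → List Bool
  | .const b => [b]
  | .nand i j => [!(w.getD i false && w.getD j false)]
  | .oracle q => O (q.map fun i => w.getD i false)

def Gate.size : Gate → ℕ
  | .const _ => 1
  | .nand _ _ => 1
  | .oracle q => 1 + q.length

/-- A Boolean oracle circuit: gates in order of evaluation, and the list of output wires. -/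
structure Circuit where
  gates : List Gate
  out : List ℕ

/-- The number of elementary steps in an evaluation of the circuit. -/
def Circuit.size (C : Circuit) : ℕ := (C.gates.map Gate.size).sum + C.out.length

/-- The output bits of `C` on the input `inp`, with access to the oracle `O`. -/
def Circuit.eval (C : Circuit) (O : List Bool → List Bool) (inp : List Bool) : List Bool :=
  let w := C.gates.foldl (fun w g => w ++ g.run O w) inp
  C.out.map fun i => w.getD i false

/-- The trivial oracle, for circuits without oracle access. -/
def noOracle : List Bool → List Bool := fun _ => []

/-- A (non-uniform) probabilistic oracle algorithm: for each security parameter an oracle circuit,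
which receives its input followed by `coins lam` uniformly random bits. It accepts when its first
output bit is `true`. -/
structure Adversary where
  coins : ℕ → ℕ
  circ : ℕ → Circuit

/-- The adversary runs in (non-uniform, probabilistic) polynomial time. -/
def Adversary.PolyTime (A : Adversary) : Prop :=
  PolyBounded fun lam => A.coins lam + (A.circ lam).size

/-- The random decision of `A` on input `inp`, with access to the oracle `O`. -/
def Adversary.run (A : Adversary) (lam : ℕ) (O : List Bool → List Bool) (inp : List Bool) :
    PMF Bool :=
  (unif (Fin (A.coins lam) → Bool)).map fun c =>
    ((A.circ lam).eval O (inp ++ List.ofFn c)).headD false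

/-- The distinguishing advantage between two games that end in a decision. -/
def advantage (P Q : PMF Bool) : ℝ := |(P true).toReal - (Q true).toReal|

/-- Computational indistinguishability of two ensembles: the samples are bit strings of a
polynomially bounded length that depends only on `lam`, and every polynomial-time distinguisher
has a negligible advantage. -/
def CompIndist (X Y : ℕ → PMF (List Bool)) : Prop :=
  (∃ len : ℕ → ℕ, PolyBounded len ∧
    ∀ lam, (∀ s ∈ (X lam).support, s.length = len lam) ∧
      (∀ s ∈ (Y lam).support, s.length = len lam)) ∧
  ∀ D : Adversary, D.PolyTime →
    Negligible fun lam =>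
      advantage ((X lam).bind (D.run lam noOracle)) ((Y lam).bind (D.run lam noOracle))

/-! ## Key-homomorphic pseudorandom functions -/

/-- Oracle access to a function `f : R → L ^ m` through bit encodings. A query that does not encode
an element of `R` is answered by the empty string. -/
def oracleOf {R L : Type} (eR : BitEncoding R) (eL : BitEncoding L) {m : ℕ}
    (f : R → Fin m → L) : List Bool → List Bool := fun q =>
  open Classical in
  if h : ∃ r, eR.bits r = q then eL.vecBits (f h.choose) else []

/-- Security of a PRF family `Φ lam : K lam × R lam → L ^ (m lam)` with uniformly distributed key:
no polynomial-time adversary with adaptive oracle access can distinguish `Φ lam k` from a uniformly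
random function. -/
def IsSecurePRF {L : Type} [Finite L] [Nonempty L] (eL : BitEncoding L)
    {K R : ℕ → Type} [∀ lam, Finite (K lam)] [∀ lam, Nonempty (K lam)] [∀ lam, Finite (R lam)]
    (eR : ∀ lam, BitEncoding (R lam)) {m : ℕ → ℕ}
    (Φ : ∀ lam, K lam → R lam → Fin (m lam) → L) : Prop :=
  ∀ A : Adversary, A.PolyTime →
    Negligible fun lam =>
      advantage
        ((unif (K lam)).bind fun k => A.run lam (oracleOf (eR lam) eL (Φ lam k)) [])
        ((unif (R lam → Fin (m lam) → L)).bind fun U => A.run lam (oracleOf (eR lam) eL U) [])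

/-- `𝔽`-key-homomorphic PRF families. The encodings of keys and inputs have polynomial length. -/
structure IsKeyHomomorphicPRF (𝔽 : Type) {L : Type} [Field 𝔽] [Field L] [Finite L] [Algebra 𝔽 L]
    (eL : BitEncoding L) {K R : ℕ → Type} [∀ lam, Field (K lam)] [∀ lam, Finite (K lam)]
    [∀ lam, Algebra 𝔽 (K lam)] [∀ lam, Finite (R lam)]
    (eK : ∀ lam, BitEncoding (K lam)) (eR : ∀ lam, BitEncoding (R lam)) {m : ℕ → ℕ}
    (Φ : ∀ lam, K lam → R lam → Fin (m lam) → L) : Prop where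
  key_length : PolyBounded fun lam => (eK lam).len
  input_length : PolyBounded fun lam => (eR lam).len
  efficient : ∃ C : ℕ → Circuit, (PolyBounded fun lam => (C lam).size) ∧
    ∀ lam k r, (C lam).eval noOracle ((eK lam).bits k ++ (eR lam).bits r) =
      eL.vecBits (Φ lam k r)
  secure : IsSecurePRF eL eR Φ
  map_add : ∀ lam k₁ k₂ r, Φ lam (k₁ + k₂) r = Φ lam k₁ r + Φ lam k₂ r
  map_smul : ∀ lam (c : 𝔽) k r, Φ lam (c • k) r = c • Φ lam k r

/-! ## Multi-evaluation threshold distributed point functions -/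

/-- The algorithms of a `t`-out-of-`n` DPF scheme for point functions `{0,1}^ℓ → L`, together with
the representation of key shares and output shares by bit strings. -/
structure DPFScheme (n t ℓ : ℕ) (L : Type) (R : ℕ → Type) where
  Key : ℕ → Type
  Out : ℕ → Type
  gen : ∀ lam, (Fin ℓ → Bool) → L → PMF (Fin n → Key lam)
  eval : ∀ lam, Key lam → (Fin ℓ → Bool) → R lam → Out lam
  reconstruct : ∀ lam, (Fin t → Out lam) → L
  keyBits : ∀ lam, Key lam → List Bool
  outBits : ∀ lam, Out lam → List Bool

namespace DPFScheme

variable {n t ℓ : ℕ} {L : Type} {R : ℕ → Type}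

/-- The distribution of the value reconstructed at `x` by the parties `e 0, …, e (t-1)`. -/
def result (Sch : DPFScheme n t ℓ L R) (lam : ℕ) (a : Fin ℓ → Bool) (α : L) (e : Fin t ↪ Fin n)
    (x : Fin ℓ → Bool) (r : R lam) : PMF L :=
  (Sch.gen lam a α).map fun f => Sch.reconstruct lam fun i => Sch.eval lam (f (e i)) x r

/-- The joint distribution of the key shares of the parties in `S`. -/
def shares (Sch : DPFScheme n t ℓ L R) (lam : ℕ) (a : Fin ℓ → Bool) (α : L) (S : Finset (Fin n)) :
    PMF (S → Sch.Key lam) :=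
  (Sch.gen lam a α).map fun f i => f i

/-- The distribution (as a bit string) of the key shares of the parties in `S` together with the
output shares of all `n` parties at the evaluations `(x 0, r 0), …, (x (m-1), r (m-1))`. -/
def view (Sch : DPFScheme n t ℓ L R) (lam : ℕ) (a : Fin ℓ → Bool) (α : L) (S : Finset (Fin n))
    {m : ℕ} (x : Fin m → Fin ℓ → Bool) (r : Fin m → R lam) : PMF (List Bool) :=
  (Sch.gen lam a α).map fun f =>
    (((List.finRange n).filter fun i => i ∈ S).flatMap fun i => Sch.keyBits lam (f i)) ++
    ((List.finRange n).flatMap fun i => (List.finRange m).flatMap fun h =>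
      Sch.outBits lam (Sch.eval lam (f i) (x h) (r h)))

/-- A `t`-out-of-`n` computational multi-evaluation DPF scheme. In `multiEval` all the data,
including the number `m lam` of evaluations, may depend on the security parameter. -/
structure IsMultiEvalThresholdDPF [Zero L] (Sch : DPFScheme n t ℓ L R) : Prop where
  correct_at : ∀ lam a α e r, Sch.result lam a α e a r α = 1
  correct_off : ∃ ε : ℕ → ℝ, Negligible ε ∧
    ∀ lam a α e x r, x ≠ a → (Sch.result lam a α e x r 0).toReal > 1 - ε lam
  secrecy : ∀ lam a b α β (S : Finset (Fin n)), S.card < t →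
    Sch.shares lam a α S = Sch.shares lam b β S
  multiEval : ∀ (a b : ℕ → Fin ℓ → Bool) (α β : ℕ → L) (S : ℕ → Finset (Fin n)) (m : ℕ → ℕ)
    (x : ∀ lam, Fin (m lam) → Fin ℓ → Bool) (r : ∀ lam, Fin (m lam) → R lam),
    (∀ lam, (S lam).card < t) → PolyBounded m →
    (∀ lam h, x lam h ≠ a lam ∧ x lam h ≠ b lam) → (∀ lam, Function.Injective (r lam)) →
    CompIndist (fun lam => Sch.view lam (a lam) (α lam) (S lam) (x lam) (r lam))
      (fun lam => Sch.view lam (b lam) (β lam) (S lam) (x lam) (r lam))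

end DPFScheme

/-! ## The Shamir-based scheme -/

/-- The index set of the `2ℓ` vectors, values and keys: `(j, b)` stands for the index `2j + b`. -/
abbrev Idx (ℓ : ℕ) : Type := Fin ℓ × Bool

/-- The value at `x` of the polynomial of degree at most `t - 1` with coefficients `c`. -/
def polyVal {k : Type} [Field k] {t : ℕ} (c : Fin t → k) (x : k) : k :=
  ∑ d : Fin t, c d * x ^ (d : ℕ)

/-- Families of polynomials of degree at most `t - 1` with prescribed values at `x₀`. -/
abbrev SharingPolys (t : ℕ) {k : Type} [Field k] {I : Type} (x₀ : k) (s : I → k) : Type :=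
  {c : I → Fin t → k // ∀ i, polyVal (c i) x₀ = s i}

theorem nonempty_sharingPolys {t : ℕ} (ht : 1 ≤ t) {k : Type} [Field k] {I : Type} (x₀ : k)
    (s : I → k) : Nonempty (SharingPolys t x₀ s) := by
  obtain ⟨u, rfl⟩ : ∃ u, t = u + 1 := ⟨t - 1, by omega⟩
  refine ⟨⟨fun i d => if d = 0 then s i else 0, fun i => ?_⟩⟩
  simp [polyVal]

theorem nonempty_splittings {ℓ : ℕ} (hℓ : 1 ≤ ℓ) {L : Type} [Field L] (a : Fin ℓ → Bool) (α : L) :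
    Nonempty {αv : Idx ℓ → L // ∑ j, αv (j, a j) = α} := by
  obtain ⟨u, rfl⟩ : ∃ u, ℓ = u + 1 := ⟨ℓ - 1, by omega⟩
  refine ⟨⟨fun i => if i.1 = 0 then α else 0, ?_⟩⟩
  simp

/-- The key share `f_i`. -/
structure ShamirKey (n ℓ N : ℕ) (L K : Type) where
  party : Fin n
  /-- the shares `v_{i,j}` -/
  v : Idx ℓ → Fin N → L
  θ : Fin N → L
  /-- the shares `α_{i,j}` -/
  α : Idx ℓ → L
  /-- the keys `k_{i,j}` -/
  ownKeys : Idx ℓ → K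
  /-- the shares `k_{i',j,i}` of the keys `k_{i',j}` of all parties `i'` -/
  keyShares : Fin n → Idx ℓ → K
  keySum : K

/-- The output share `s_i`. -/
structure ShamirOut (n N : ℕ) (L K R : Type) where
  party : Fin n
  s₀ : Fin N → L
  s₁ : L
  r : R
  θ : Fin N → L
  keySum : K

def partyBits {n : ℕ} (i : Fin n) : List Bool := List.ofFn fun i' => decide (i' = i)

def idxList (ℓ : ℕ) : List (Idx ℓ) :=
  (List.finRange ℓ).flatMap fun j => [(j, false), (j, true)]

def ShamirKey.bits {n ℓ N : ℕ} {L K : Type} (eL : BitEncoding L) (eK : BitEncoding K)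
    (f : ShamirKey n ℓ N L K) : List Bool :=
  partyBits f.party ++
  ((idxList ℓ).flatMap fun j => eL.vecBits (f.v j)) ++
  eL.vecBits f.θ ++
  ((idxList ℓ).flatMap fun j => eL.bits (f.α j)) ++
  ((idxList ℓ).flatMap fun j => eK.bits (f.ownKeys j)) ++
  ((List.finRange n).flatMap fun i => (idxList ℓ).flatMap fun j => eK.bits (f.keyShares i j)) ++
  eK.bits f.keySum

def ShamirOut.bits {n N : ℕ} {L K R : Type} (eL : BitEncoding L) (eK : BitEncoding K)
    (eR : BitEncoding R) (s : ShamirOut n N L K R) : List Bool :=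
  partyBits s.party ++ eL.vecBits s.s₀ ++ eL.bits s.s₁ ++ eR.bits s.r ++ eL.vecBits s.θ ++
  eK.bits s.keySum

/-- Key generation. The point `ι 0` carries the secrets, and `ι i.succ` is the point of
party `i`. The keys `k_{i,j}` are linearly independent over the subfield `k₀` of `𝔽`; the choices
`k₀ = ⊤` (independence over `𝔽`) and `k₀ = ⊥` (over the prime field) are both possible. -/
def shamirGen {n t ℓ N : ℕ} (ht : 1 ≤ t) (hℓ : 1 ≤ ℓ) {𝔽 L K : Type} [Field 𝔽] [Field L] [Field K]
    [Finite L] [Finite K] [Algebra 𝔽 L] [Algebra 𝔽 K] (ι : Fin (n + 1) → 𝔽)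
    (k₀ : Subfield 𝔽) (hK : ∃ κ : Fin n × Idx ℓ → K, LinearIndependent k₀ κ) (a : Fin ℓ → Bool) (α : L) :
    PMF (Fin n → ShamirKey n ℓ N L K) :=
  let ptL : Fin (n + 1) → L := fun i => algebraMap 𝔽 L (ι i)
  let ptK : Fin (n + 1) → K := fun i => algebraMap 𝔽 K (ι i)
  -- the vectors `v_j` and their sharing polynomials
  (unif (Idx ℓ × Fin N → L)).bind fun v =>
  haveI := nonempty_sharingPolys ht (ptL 0) v
  (unif (SharingPolys t (ptL 0) v)).bind fun rp =>
  -- the elements `α_j` and their sharing polynomials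
  haveI := nonempty_splittings hℓ a α
  (unif {αv : Idx ℓ → L // ∑ j, αv (j, a j) = α}).bind fun αv =>
  haveI := nonempty_sharingPolys ht (ptL 0) αv.1
  (unif (SharingPolys t (ptL 0) αv.1)).bind fun αp =>
  -- the linearly independent keys `k_{i,j}` and their sharing polynomials
  haveI : Nonempty {κ : Fin n × Idx ℓ → K // LinearIndependent k₀ κ} :=
    hK.elim fun κ hκ => ⟨⟨κ, hκ⟩⟩
  (unif {κ : Fin n × Idx ℓ → K // LinearIndependent k₀ κ}).bind fun κ =>
  haveI := nonempty_sharingPolys ht (ptK 0) κ.1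
  (unif (SharingPolys t (ptK 0) κ.1)).bind fun kp =>
  PMF.pure fun i =>
    { party := i
      v := fun j h => polyVal (rp.1 (j, h)) (ptL i.succ)
      θ := fun h => ∑ j, v ((j, a j), h)
      α := fun j => polyVal (αp.1 j) (ptL i.succ)
      ownKeys := fun j => κ.1 (i, j)
      keyShares := fun i' j => polyVal (kp.1 (i', j)) (ptK i.succ)
      keySum := ∑ i', ∑ j, κ.1 (i', (j, a j)) }

/-- The component `F₁` of `F = (F₁, F₂)`. -/
def prfFst {K R L : Type} {N : ℕ} (Φ : K → R → Fin (N + 1) → L) (k : K) (r : R) : Fin N → L :=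
  fun h => Φ k r h.castSucc

/-- The component `F₂` of `F = (F₁, F₂)`. -/
def prfSnd {K R L : Type} {N : ℕ} (Φ : K → R → Fin (N + 1) → L) (k : K) (r : R) : L :=
  Φ k r (Fin.last N)

def shamirEval {n ℓ N : ℕ} {L K R : Type} [Field L] (Φ : K → R → Fin (N + 1) → L)
    (f : ShamirKey n ℓ N L K) (x : Fin ℓ → Bool) (r : R) : ShamirOut n N L K R where
  party := f.party
  s₀ := ∑ j, (f.v (j, x j) + ∑ l, prfFst Φ (f.keyShares l (j, x j)) r)
  s₁ := ∑ j, (f.α (j, x j) + ∑ l, prfSnd Φ (f.keyShares l (j, x j)) r)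
  r := r
  θ := f.θ
  keySum := f.keySum

/-- The value at `ι 0` of the polynomial of degree at most `t - 1` that takes the values `y` at the
points of the `t` given parties. -/
def interpolateSecret {n t : ℕ} {𝔽 L : Type} [Field 𝔽] [Field L] [Algebra 𝔽 L]
    (ι : Fin (n + 1) → 𝔽) (party : Fin t → Fin n) (y : Fin t → L) : L :=
  (Lagrange.interpolate Finset.univ (fun i => algebraMap 𝔽 L (ι (party i).succ)) y).eval
    (algebraMap 𝔽 L (ι 0))

/-- Reconstruction. The components `r`, `θ`, `k` agree in all shares and are read off the first. -/
def shamirRec {n t N : ℕ} (ht : 1 ≤ t) {𝔽 L K R : Type} [Field 𝔽] [Field L] [Algebra 𝔽 L]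
    (ι : Fin (n + 1) → 𝔽) (Φ : K → R → Fin (N + 1) → L) (s : Fin t → ShamirOut n N L K R) : L :=
  let s' := s ⟨0, ht⟩
  open Classical in
  if (fun h => interpolateSecret ι (fun i => (s i).party) fun i => (s i).s₀ h) =
      s'.θ + prfFst Φ s'.keySum s'.r then
    interpolateSecret ι (fun i => (s i).party) (fun i => (s i).s₁) - prfSnd Φ s'.keySum s'.r
  else 0

/-- The Shamir-based DPF scheme built from a family `Φ lam : K lam × R lam → L ^ (2ℓ + lam + 1)`. -/
def shamirDPF {n t ℓ : ℕ} (ht : 1 ≤ t) (hℓ : 1 ≤ ℓ) {𝔽 L : Type} [Field 𝔽] [Field L] [Finite L]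
    [Algebra 𝔽 L] (ι : Fin (n + 1) → 𝔽) {K R : ℕ → Type} [∀ lam, Field (K lam)]
    [∀ lam, Finite (K lam)] [∀ lam, Algebra 𝔽 (K lam)]
    (eL : BitEncoding L) (eK : ∀ lam, BitEncoding (K lam)) (eR : ∀ lam, BitEncoding (R lam))
    (Φ : ∀ lam, K lam → R lam → Fin (2 * ℓ + lam + 1) → L)
    (k₀ : Subfield 𝔽) (hK : ∀ lam, ∃ κ : Fin n × Idx ℓ → K lam, LinearIndependent k₀ κ) :
    DPFScheme n t ℓ L R where
  Key lam := ShamirKey n ℓ (2 * ℓ + lam) L (K lam)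
  Out lam := ShamirOut n (2 * ℓ + lam) L (K lam) (R lam)
  gen lam a α := shamirGen ht hℓ ι k₀ (hK lam) a α
  eval lam := shamirEval (Φ lam)
  reconstruct lam := shamirRec ht ι (Φ lam)
  keyBits lam := ShamirKey.bits eL (eK lam)
  outBits lam := ShamirOut.bits eL (eK lam) (eR lam)

end

noncomputable section

/-! ## Polynomially bounded functions -/

theorem PolyBounded.mono {f g : ℕ → ℕ} (hg : PolyBounded g) (h : ∀ lam, f lam ≤ g lam) :
    PolyBounded f := by
  obtain ⟨p, hp⟩ := hg
  exact ⟨p, fun lam => (h lam).trans (hp lam)⟩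

theorem PolyBounded.const (c : ℕ) : PolyBounded fun _ => c :=
  ⟨Polynomial.C c, fun lam => by simp⟩

theorem PolyBounded.id : PolyBounded fun lam => lam :=
  ⟨Polynomial.X, fun lam => by simp⟩

theorem PolyBounded.add {f g : ℕ → ℕ} (hf : PolyBounded f) (hg : PolyBounded g) :
    PolyBounded fun lam => f lam + g lam := by
  obtain ⟨p, hp⟩ := hf
  obtain ⟨q, hq⟩ := hg
  exact ⟨p + q, fun lam => by simpa using add_le_add (hp lam) (hq lam)⟩

theorem PolyBounded.mul {f g : ℕ → ℕ} (hf : PolyBounded f) (hg : PolyBounded g) :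
    PolyBounded fun lam => f lam * g lam := by
  obtain ⟨p, hp⟩ := hf
  obtain ⟨q, hq⟩ := hg
  exact ⟨p * q, fun lam => by simpa using Nat.mul_le_mul (hp lam) (hq lam)⟩

/-! ## Boolean formulas and their compilation to gates -/

/-- Boolean formulas over the variables `V`. -/
inductive Form (V : Type) where
  | const (b : Bool)
  | var (v : V)
  | nand (f g : Form V)

namespace Form

variable {V : Type}

def eval (env : V → Bool) : Form V → Bool
  | .const b => b
  | .var v => env v
  | .nand f g => !(f.eval env && g.eval env)

def size : Form V → ℕ
  | .const _ => 1
  | .var _ => 1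
  | .nand f g => f.size + g.size + 1

def not (f : Form V) : Form V := .nand f (.const true)

def and (f g : Form V) : Form V := (Form.nand f g).not

@[simp] theorem eval_not (env : V → Bool) (f : Form V) : f.not.eval env = !f.eval env := by
  simp [not, eval]

@[simp] theorem size_not (f : Form V) : f.not.size = f.size + 2 := by
  simp [not, size]

@[simp] theorem eval_and (env : V → Bool) (f g : Form V) :
    (f.and g).eval env = (f.eval env && g.eval env) := by
  simp [and, eval]

@[simp] theorem size_and (f g : Form V) : (f.and g).size = f.size + g.size + 3 := by
  simp [and, size]

/-- The conjunction of a list of formulas. -/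
def all : List (Form V) → Form V
  | [] => .const true
  | f :: l => f.and (all l)

theorem eval_all (env : V → Bool) (l : List (Form V)) :
    (all l).eval env = true ↔ ∀ f ∈ l, f.eval env = true := by
  induction l with
  | nil => simp [all, eval]
  | cons f l ih => simp [all, ih]

theorem size_all {l : List (Form V)} {C : ℕ} (h : ∀ f ∈ l, f.size ≤ C) :
    (all l).size ≤ l.length * (C + 3) + 1 := by
  induction l with
  | nil => simp [all, size]
  | cons f l ih =>
    have h1 := h f (by simp)
    have h2 := ih fun f' hf' => h f' (by simp [hf'])
    simp only [all, size_and, List.length_cons, Nat.add_mul]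
    omega

/-- The formula that applies an arbitrary Boolean function to the variables in a list. -/
def table : List V → (List Bool → Bool) → Form V
  | [], φ => .const (φ [])
  | v :: l, φ =>
    .nand (.nand (.var v) (table l fun s => φ (true :: s)))
      (.nand (Form.not (.var v)) (table l fun s => φ (false :: s)))

theorem eval_table (env : V → Bool) (l : List V) (φ : List Bool → Bool) :
    (table l φ).eval env = φ (l.map env) := by
  induction l generalizing φ with
  | nil => simp [table, eval]
  | cons v l ih => cases h : env v <;> simp [table, eval, ih, h]

/-- The size of `table l φ` for a list of length `d`. -/
def tableSize : ℕ → ℕ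
  | 0 => 1
  | d + 1 => 2 * tableSize d + 7

theorem size_table (l : List V) (φ : List Bool → Bool) :
    (table l φ).size = tableSize l.length := by
  induction l generalizing φ with
  | nil => simp [table, size, tableSize]
  | cons v l ih => simp [table, size, tableSize, ih]; omega

end Form

/-- The wires after running the gates `G` on the wires `w`. -/
def runGates (O : List Bool → List Bool) (G : List Gate) (w : List Bool) : List Bool :=
  G.foldl (fun w g => w ++ g.run O w) w

theorem runGates_append (O : List Bool → List Bool) (G G' : List Gate) (w : List Bool) :
    runGates O (G ++ G') w = runGates O G' (runGates O G w) := by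
  simp [runGates]

theorem runGates_cons (O : List Bool → List Bool) (g : Gate) (G : List Gate) (w : List Bool) :
    runGates O (g :: G) w = runGates O G (w ++ g.run O w) := by
  simp [runGates]

theorem Circuit.eval_eq (C : Circuit) (O : List Bool → List Bool) (inp : List Bool) :
    C.eval O inp = C.out.map fun i => (runGates O C.gates inp).getD i false := rfl

def gatesSize (G : List Gate) : ℕ := (G.map Gate.size).sum

@[simp] theorem gatesSize_nil : gatesSize [] = 0 := rfl

@[simp] theorem gatesSize_cons (g : Gate) (G : List Gate) :
    gatesSize (g :: G) = g.size + gatesSize G := by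
  simp [gatesSize]

@[simp] theorem gatesSize_append (G G' : List Gate) :
    gatesSize (G ++ G') = gatesSize G + gatesSize G' := by
  simp [gatesSize]

theorem Form.exists_gates {V : Type} (pos : V → ℕ) (f : Form V) (B : ℕ) (hpos : ∀ v, pos v < B) :
    ∃ (G : List Gate) (p : ℕ), p < B + G.length ∧ gatesSize G ≤ f.size ∧
      ∀ O w, w.length = B → ∃ ext, ext.length = G.length ∧ runGates O G w = w ++ ext ∧
        (w ++ ext).getD p false = f.eval fun v => w.getD (pos v) false := by
  induction f generalizing B with
  | const b =>
    refine ⟨[.const b], B, by simp, by simp [Gate.size, Form.size], fun O w hw => ⟨[b], ?_⟩⟩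
    subst hw
    simp [runGates, Gate.run, Form.eval]
  | var v =>
    refine ⟨[], pos v, by simpa using hpos v, by simp, fun O w hw => ⟨[], ?_⟩⟩
    simp [runGates, Form.eval]
  | nand f g ihf ihg =>
    obtain ⟨G, p, hp, hs, h⟩ := ihf B hpos
    obtain ⟨G', p', hp', hs', h'⟩ := ihg (B + G.length) fun v => (hpos v).trans_le (by omega)
    refine ⟨G ++ G' ++ [.nand p p'], B + G.length + G'.length, by simp; omega,
      by simp [Gate.size, Form.size]; omega, fun O w hw => ?_⟩
    obtain ⟨e, he, hr, hv⟩ := h O w hw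
    obtain ⟨e', he', hr', hv'⟩ := h' O (w ++ e) (by simp [hw, he])
    refine ⟨e ++ e' ++ [!(f.eval (fun v => w.getD (pos v) false) &&
      g.eval (fun v => w.getD (pos v) false))], by simp [he, he'], ?_, ?_⟩
    · have h1 : (w ++ e ++ e').getD p false = f.eval fun v => w.getD (pos v) false := by
        rw [List.getD_append _ _ _ _ (by simp [hw, he]; omega), hv]
      have h2 : (w ++ e ++ e').getD p' false = g.eval fun v => w.getD (pos v) false := by
        rw [hv']
        congr 1
        funext v
        rw [List.getD_append _ _ _ _ (by rw [hw]; exact hpos v)]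
      rw [runGates_append, runGates_append, hr, hr']
      simp only [runGates, List.foldl_cons, List.foldl_nil, Gate.run, h1, h2]
      simp
    · have : B + G.length + G'.length = (w ++ e ++ e').length := by simp [hw, he, he']; omega
      rw [this, ← List.append_assoc, ← List.append_assoc, List.getD_append_right _ _ _ _ le_rfl]
      simp [Form.eval]

theorem Form.exists_gates_list {V : Type} (pos : V → ℕ) (Fs : List (Form V)) (B : ℕ)
    (hpos : ∀ v, pos v < B) :
    ∃ (G : List Gate) (ps : List ℕ), ps.length = Fs.length ∧ (∀ p ∈ ps, p < B + G.length) ∧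
      gatesSize G ≤ (Fs.map Form.size).sum ∧
      ∀ O w, w.length = B → ∃ ext, ext.length = G.length ∧ runGates O G w = w ++ ext ∧
        (ps.map fun p => (w ++ ext).getD p false) =
          Fs.map (Form.eval fun v => w.getD (pos v) false) := by
  induction Fs generalizing B with
  | nil => exact ⟨[], [], rfl, by simp, by simp, fun O w _ => ⟨[], by simp [runGates]⟩⟩
  | cons f Fs ih =>
    obtain ⟨G, p, hp, hs, h⟩ := f.exists_gates pos B hpos
    obtain ⟨G', ps, hl, hps, hs', h'⟩ := ih (B + G.length) fun v => (hpos v).trans_le (by omega)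
    refine ⟨G ++ G', p :: ps, by simp [hl], ?_, by simp; omega, fun O w hw => ?_⟩
    · intro x hx
      rw [List.length_append]
      rcases List.mem_cons.1 hx with rfl | hx
      · omega
      · have := hps x hx; omega
    obtain ⟨e, he, hr, hv⟩ := h O w hw
    obtain ⟨e', he', hr', hv'⟩ := h' O (w ++ e) (by simp [hw, he])
    refine ⟨e ++ e', by simp [he, he'], by rw [runGates_append, hr, hr', List.append_assoc], ?_⟩
    rw [← List.append_assoc, List.map_cons, List.map_cons, hv',
      List.getD_append _ _ _ _ (by simp [hw, he]; omega), hv]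
    congr 2
    funext f'
    congr 1
    funext v
    rw [List.getD_append _ _ _ _ (by rw [hw]; exact hpos v)]

/-- Compilation of a list of formulas, with the values on consecutive new wires. -/
theorem Form.exists_gates_consecutive {V : Type} (pos : V → ℕ) (Fs : List (Form V)) (B : ℕ)
    (hpos : ∀ v, pos v < B) :
    ∃ (G : List Gate) (k : ℕ), gatesSize G ≤ (Fs.map fun f => f.size + 3).sum ∧
      ∀ O w, w.length = B → ∃ ext, ext.length = k ∧ runGates O G w =
        w ++ ext ++ Fs.map (Form.eval fun v => w.getD (pos v) false) := by
  obtain ⟨G, ps, hl, hps, hs, h⟩ := Form.exists_gates_list pos (Fs.map Form.not) B hpos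
  refine ⟨G ++ ps.map fun p => .nand p p, G.length, ?_, fun O w hw => ?_⟩
  · have h1 : gatesSize (ps.map fun p => Gate.nand p p) = Fs.length := by
      rw [List.length_map] at hl
      rw [← hl]
      clear hl hps h
      induction ps with
      | nil => simp
      | cons p ps ih => simp [Gate.size, ih]; omega
    rw [gatesSize_append, h1]
    rw [List.map_map] at hs
    refine (Nat.add_le_add_right hs _).trans ?_
    clear * -
    induction Fs with
    | nil => simp
    | cons f Fs ih => simp only [List.map_cons, List.sum_cons, List.length_cons,
        Function.comp_apply, size_not] at ih ⊢; omega
  · obtain ⟨e, he, hr, hv⟩ := h O w hw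
    refine ⟨e, he, ?_⟩
    have key : ∀ (qs : List ℕ) (u : List Bool), (∀ p ∈ qs, p < (w ++ e).length) →
        runGates O (qs.map fun p => .nand p p) (w ++ e ++ u) =
          w ++ e ++ u ++ qs.map fun p => !(w ++ e).getD p false := by
      intro qs
      induction qs with
      | nil => intro u _; simp [runGates]
      | cons p qs ih =>
        intro u hq
        rw [List.map_cons, runGates_cons]
        simp only [Gate.run]
        rw [List.getD_append _ _ _ _ (hq p (by simp)), List.append_assoc (w ++ e) u,
          ih _ fun p' hp' => hq p' (by simp [hp'])]
        simp
    have hk := key ps [] fun p hp => by have := hps p hp; simp [hw, he]; omega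
    simp only [List.append_nil] at hk
    rw [runGates_append, hr, hk]
    congr 1
    have : (ps.map fun p => !(w ++ e).getD p false) =
        (ps.map fun p => (w ++ e).getD p false).map Bool.not := by simp
    rw [this, hv]
    simp

theorem length_flatMap_const {X Y : Type} (l : List X) (f : X → List Y) {d : ℕ}
    (hf : ∀ x ∈ l, (f x).length = d) : (l.flatMap f).length = l.length * d := by
  induction l with
  | nil => simp
  | cons x l ih =>
    rw [List.flatMap_cons, List.length_append, hf x (by simp),
      ih fun y hy => hf y (by simp [hy]), List.length_cons]
    ring

theorem length_flatMap_finRange {Y : Type} {m d : ℕ} (f : Fin m → List Y)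
    (hf : ∀ h, (f h).length = d) : ((List.finRange m).flatMap f).length = m * d := by
  rw [length_flatMap_const _ _ fun h _ => hf h, List.length_finRange]

theorem getD_flatMap_finRange {m d : ℕ} (f : Fin m → List Bool) (hf : ∀ h, (f h).length = d)
    (h : Fin m) {b : ℕ} (hb : b < d) :
    ((List.finRange m).flatMap f).getD (h * d + b) false = (f h).getD b false := by
  induction m with
  | zero => exact h.elim0
  | succ m ih =>
    rw [List.finRange_succ, List.flatMap_cons, List.flatMap_map]
    refine Fin.cases ?_ (fun h => ?_) h
    · rw [List.getD_append _ _ _ _ (by simpa [hf] using hb)]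
      simp
    · rw [List.getD_append_right _ _ _ _ (by rw [hf, Fin.val_succ]; nlinarith), hf,
        ← ih (fun i => f i.succ) (fun i => hf _) h]
      congr 1
      rw [Fin.val_succ, Nat.add_mul]
      omega

theorem BitEncoding.length_vecBits {X : Type} (e : BitEncoding X) {m : ℕ} (v : Fin m → X) :
    (e.vecBits v).length = m * e.len :=
  length_flatMap_finRange _ fun _ => e.length_bits _

theorem oracleOf_bits {R L : Type} (eR : BitEncoding R) (eL : BitEncoding L) {m : ℕ}
    (f : R → Fin m → L) (r : R) : oracleOf eR eL f (eR.bits r) = eL.vecBits (f r) := by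
  have h : ∃ r', eR.bits r' = eR.bits r := ⟨r, rfl⟩
  rw [oracleOf, dif_pos h, eR.injective h.choose_spec]

/-- Renaming of variables. -/
def Form.rename {V W : Type} (ρ : V → W) : Form V → Form W
  | .const b => .const b
  | .var v => .var (ρ v)
  | .nand f g => .nand (f.rename ρ) (g.rename ρ)

theorem Form.eval_rename {V W : Type} (ρ : V → W) (env : W → Bool) (f : Form V) :
    (f.rename ρ).eval env = f.eval fun v => env (ρ v) := by
  induction f with
  | const b => rfl
  | var v => rfl
  | nand f g hf hg => simp [rename, eval, hf, hg]

theorem Form.size_rename {V W : Type} (ρ : V → W) (f : Form V) :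
    (f.rename ρ).size = f.size := by
  induction f with
  | const b => rfl
  | var v => rfl
  | nand f g hf hg => simp [rename, size, hf, hg]

/-- A gate without oracle access, moved to a circuit in which `B` wires precede. -/
def Gate.shift (B : ℕ) : Gate → List Gate
  | .const b => [.const b]
  | .nand i j => [.nand (B + i) (B + j)]
  | .oracle _ => []

theorem getD_append_add (u w : List Bool) (i : ℕ) :
    (u ++ w).getD (u.length + i) false = w.getD i false := by
  rw [List.getD_append_right _ _ _ _ (by omega)]
  simp

theorem runGates_shift (O : List Bool → List Bool) (u : List Bool) (G : List Gate)
    (w : List Bool) :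
    runGates O (G.flatMap (Gate.shift u.length)) (u ++ w) = u ++ runGates noOracle G w := by
  induction G generalizing w with
  | nil => simp [runGates]
  | cons g G ih =>
    rw [List.flatMap_cons, runGates_append, runGates_cons, ← ih]
    congr 1
    cases g with
    | const b => simp [Gate.shift, runGates, Gate.run]
    | nand i j =>
      simp only [Gate.shift, runGates, Gate.run, List.foldl_cons, List.foldl_nil, getD_append_add,
        List.append_assoc]
    | oracle q => simp [Gate.shift, runGates, Gate.run, noOracle]

theorem gatesSize_shift (B : ℕ) (G : List Gate) :
    gatesSize (G.flatMap (Gate.shift B)) ≤ gatesSize G := by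
  induction G with
  | nil => simp
  | cons g G ih =>
    rw [List.flatMap_cons, gatesSize_append, gatesSize_cons]
    refine add_le_add ?_ ih
    cases g <;> simp [Gate.shift, Gate.size]

/-- The assignment to the variables `(h, c, b)` given by the bits of the entries of `y`. -/
def bitEnv {L : Type} (eL : BitEncoding L) {m N : ℕ} (y : Fin m → Fin N → L) :
    Fin m × Fin N × Fin eL.len → Bool :=
  fun v => (eL.bits (y v.1 v.2.1)).getD v.2.2 false

/-- The circuit `D` run on `g (f (r 0), …, f (r (m-1)))` and coins, as a circuit with oracle access
to `f`, if the bits of `g` are computed by formulas. -/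
theorem exists_oracle_circuit {R L : Type} (eR : BitEncoding R) (eL : BitEncoding L) {N m : ℕ}
    (r : Fin m → R) (D : Circuit) (c : ℕ) (Fs : List (Form (Fin m × Fin N × Fin eL.len))) :
    ∃ C : Circuit, C.size ≤ 2 + m * (1 + eR.len) +
        ((Fs.map fun f => f.size + 3).sum + c * 4) + D.size ∧
      ∀ (f : R → Fin N → L) (coins : Fin c → Bool),
        C.eval (oracleOf eR eL f) (List.ofFn coins) =
          D.eval noOracle (Fs.map (Form.eval (bitEnv eL fun h => f (r h))) ++
            List.ofFn coins) := by
  classical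
  let Q : List Gate := (List.finRange m).map fun h =>
    Gate.oracle ((eR.bits (r h)).map fun b => if b then c + 1 else c)
  let pos : (Fin m × Fin N × Fin eL.len) ⊕ Fin c → ℕ := Sum.elim
    (fun v => (c + 2) + (v.1 * (N * eL.len) + (v.2.1 * eL.len + v.2.2))) fun i => i
  have hblock : ∀ {a b d e : ℕ}, a < d → b < e → a * e + b < d * e := by
    intro a b d e h1 h2
    nlinarith
  have hpos : ∀ v, pos v < c + 2 + m * (N * eL.len) := by
    rintro (⟨h, k, b⟩ | i)
    · exact Nat.add_lt_add_left (hblock h.2 (hblock k.2 b.2)) _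
    · have := i.2
      simp only [pos, Sum.elim_inr]
      omega
  let Fs' : List (Form ((Fin m × Fin N × Fin eL.len) ⊕ Fin c)) :=
    Fs.map (Form.rename Sum.inl) ++ (List.finRange c).map fun i => Form.var (Sum.inr i)
  obtain ⟨G, k, hs, hG⟩ := Form.exists_gates_consecutive pos Fs' _ hpos
  refine ⟨⟨.const false :: .const true :: (Q ++ G ++
    D.gates.flatMap (Gate.shift (c + 2 + m * (N * eL.len) + k))),
    D.out.map fun i => (c + 2 + m * (N * eL.len) + k) + i⟩, ?_, fun f coins => ?_⟩
  · have h1 : gatesSize Q = m * (1 + eR.len) := by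
      have : (Q.map Gate.size) = List.replicate m (1 + eR.len) := by
        simp only [Q, List.map_map]
        rw [List.eq_replicate_iff]
        refine ⟨by simp, fun b hb => ?_⟩
        obtain ⟨h, -, rfl⟩ := List.mem_map.1 hb
        simp [Gate.size, eR.length_bits]
      rw [gatesSize, this, List.sum_replicate, smul_eq_mul]
    have h2 : (Fs'.map fun f => f.size + 3).sum = (Fs.map fun f => f.size + 3).sum + c * 4 := by
      simp only [Fs', List.map_append, List.map_map, List.sum_append]
      congr 1
      · congr 2
        funext f
        simp [Form.size_rename]
      · have : (fun f : Form ((Fin m × Fin N × Fin eL.len) ⊕ Fin c) => f.size + 3) ∘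
            (fun i : Fin c => Form.var (Sum.inr i)) = fun _ => 4 := by
          funext i
          simp [Form.size]
        rw [this]
        simp
    rw [h2] at hs
    have h3 := gatesSize_shift (c + 2 + m * (N * eL.len) + k) D.gates
    change gatesSize _ + (D.out.map _).length ≤ _ + (gatesSize D.gates + D.out.length)
    simp only [gatesSize_cons, gatesSize_append, Gate.size, List.length_map]
    omega
  · have hQ : ∀ (l : List (Fin m)) (u : List Bool), runGates (oracleOf eR eL f)
        (l.map fun h => Gate.oracle ((eR.bits (r h)).map fun b => if b then c + 1 else c))
        (List.ofFn coins ++ [false, true] ++ u) =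
        List.ofFn coins ++ [false, true] ++ u ++ l.flatMap fun h => eL.vecBits (f (r h)) := by
      intro l
      induction l with
      | nil => intro u; simp [runGates]
      | cons h l ih =>
        intro u
        have hq : ((eR.bits (r h)).map fun b => if b then c + 1 else c).map (fun i =>
            (List.ofFn coins ++ [false, true] ++ u).getD i false) = eR.bits (r h) := by
          rw [List.map_map]
          conv_rhs => rw [← List.map_id (eR.bits (r h))]
          refine List.map_congr_left fun b _ => ?_
          cases b <;> simp
        rw [List.map_cons, runGates_cons, Gate.run, hq, oracleOf_bits,
          List.append_assoc _ u, ih, List.flatMap_cons]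
        simp
    have hQ' := hQ (List.finRange m) []
    simp only [List.append_nil] at hQ'
    set W := List.ofFn coins ++ [false, true] ++
      (List.finRange m).flatMap fun h => eL.vecBits (f (r h)) with hW
    have hlen : W.length = c + 2 + m * (N * eL.len) := by
      simp only [hW, List.length_append, List.length_ofFn]
      rw [length_flatMap_finRange _ fun h => eL.length_vecBits _]
      simp
    obtain ⟨ext, he, hr⟩ := hG (oracleOf eR eL f) W hlen
    have hin : Fs'.map (Form.eval fun v => W.getD (pos v) false) =
        Fs.map (Form.eval (bitEnv eL fun h => f (r h))) ++ List.ofFn coins := by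
      simp only [Fs', List.map_append, List.map_map]
      congr 1
      · refine List.map_congr_left fun F _ => ?_
        rw [Function.comp_apply, Form.eval_rename]
        congr 1
        funext v
        obtain ⟨h, k', b⟩ := v
        have e0 := getD_append_add (List.ofFn coins ++ [false, true])
          ((List.finRange m).flatMap fun h => eL.vecBits (f (r h)))
          (h * (N * eL.len) + (k' * eL.len + b))
        rw [List.length_append, List.length_ofFn] at e0
        refine e0.trans ?_
        rw [getD_flatMap_finRange _ (fun h => eL.length_vecBits _) _ (hblock k'.2 b.2)]
        exact getD_flatMap_finRange _ (fun _ => eL.length_bits _) _ b.2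
      · rw [List.ofFn_eq_map]
        refine List.map_congr_left fun i _ => ?_
        simp only [Function.comp_apply, Form.eval, pos, Sum.elim_inr, hW]
        rw [List.append_assoc, List.getD_append _ _ _ _ (by simp)]
        simp [List.getD_eq_getElem?_getD]
    rw [hin] at hr
    have hpre : (W ++ ext).length = c + 2 + m * (N * eL.len) + k := by simp [hlen, he]
    rw [Circuit.eval_eq, Circuit.eval_eq, List.map_map]
    have hrun : runGates (oracleOf eR eL f) (.const false :: .const true :: (Q ++ G ++
        D.gates.flatMap (Gate.shift (c + 2 + m * (N * eL.len) + k)))) (List.ofFn coins) =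
        (W ++ ext) ++ runGates noOracle D.gates
          (Fs.map (Form.eval (bitEnv eL fun h => f (r h))) ++ List.ofFn coins) := by
      rw [runGates_cons, runGates_cons, runGates_append, runGates_append]
      simp only [Gate.run]
      rw [List.append_assoc (List.ofFn coins)]
      change runGates _ _ (runGates _ _ (runGates _ Q (List.ofFn coins ++ [false, true]))) = _
      rw [hQ', hr, ← hpre, runGates_shift]
    rw [hrun]
    refine List.map_congr_left fun i _ => ?_
    rw [Function.comp_apply, ← hpre, getD_append_add]

/-! ## Negligible functions -/

theorem Negligible.mono {ε δ : ℕ → ℝ} (h : Negligible δ) (hle : ∀ lam, ε lam ≤ δ lam) :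
    Negligible ε := fun c => by
  obtain ⟨N, hN⟩ := h c
  exact ⟨N, fun lam hlam => (hle lam).trans_lt (hN lam hlam)⟩

theorem Negligible.const_mul {ε : ℕ → ℝ} (h : Negligible ε) {C : ℝ} (hC : 0 ≤ C) :
    Negligible fun lam => C * ε lam := fun c => by
  obtain ⟨N, hN⟩ := h (c + 1)
  refine ⟨max N ⌈C⌉₊, fun lam hlam => ?_⟩
  have h1 := hN lam ((le_max_left _ _).trans_lt hlam)
  have h2 : C < lam := (Nat.le_ceil C).trans_lt
    (by exact_mod_cast (le_max_right _ _).trans_lt hlam)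
  have h3 : (0 : ℝ) < lam := hC.trans_lt h2
  rcases le_or_gt (ε lam) 0 with h0 | h0
  · exact (mul_nonpos_of_nonneg_of_nonpos hC h0).trans_lt (by positivity)
  · calc C * ε lam < lam * ε lam := by gcongr
      _ ≤ lam * (1 / (lam : ℝ) ^ (c + 1)) := by gcongr
      _ = 1 / (lam : ℝ) ^ c := by field_simp; ring

theorem Negligible.add {ε δ : ℕ → ℝ} (h : Negligible ε) (h' : Negligible δ) :
    Negligible fun lam => ε lam + δ lam := fun c => by
  obtain ⟨N, hN⟩ := h.const_mul zero_le_two c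
  obtain ⟨N', hN'⟩ := h'.const_mul zero_le_two c
  refine ⟨max N N', fun lam hlam => ?_⟩
  have h1 := hN lam ((le_max_left _ _).trans_lt hlam)
  have h2 := hN' lam ((le_max_right _ _).trans_lt hlam)
  linarith

theorem negligible_one_div_two_pow : Negligible fun lam => 1 / (2 : ℝ) ^ lam := fun c => by
  have h := (tendsto_pow_const_div_const_pow_of_one_lt c one_lt_two (r := (2 : ℝ))).eventually_lt_const
    zero_lt_one
  obtain ⟨N, hN⟩ := Filter.eventually_atTop.1 h
  refine ⟨N, fun lam hlam => ?_⟩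
  have h1 := hN lam hlam.le
  have h3 : (0 : ℝ) < lam := by exact_mod_cast (Nat.zero_le N).trans_lt hlam
  rw [div_lt_one (by positivity)] at h1
  exact one_div_lt_one_div_of_lt (by positivity) h1

/-! ## Averages over finite types -/

/-- The average of a real function on a finite type. -/
def avg {X : Type} [Finite X] (f : X → ℝ) : ℝ :=
  letI := Fintype.ofFinite X
  (Fintype.card X : ℝ)⁻¹ * ∑ x, f x

section avg

variable {X Y Z : Type} [Finite X] [Finite Y] [Finite Z]

theorem avg_eq (i : Fintype X) (f : X → ℝ) :
    avg f = (Fintype.card X : ℝ)⁻¹ * ∑ x, f x := by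
  rw [Subsingleton.elim i (Fintype.ofFinite X)]
  rfl

theorem avg_mono {f g : X → ℝ} (h : ∀ x, f x ≤ g x) : avg f ≤ avg g := by
  let _ := Fintype.ofFinite X
  rw [avg_eq ‹_›, avg_eq ‹_›]
  gcongr with x
  exact h x

theorem avg_const [Nonempty X] (c : ℝ) : avg (fun _ : X => c) = c := by
  let _ := Fintype.ofFinite X
  rw [avg_eq ‹_›]
  simp

theorem avg_sub (f g : X → ℝ) : avg (fun x => f x - g x) = avg f - avg g := by
  let _ := Fintype.ofFinite X
  rw [avg_eq ‹_›, avg_eq ‹_›, avg_eq ‹_›, Finset.sum_sub_distrib, mul_sub]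

theorem avg_neg (f : X → ℝ) : avg (fun x => -f x) = -avg f := by
  let _ := Fintype.ofFinite X
  rw [avg_eq ‹_›, avg_eq ‹_›, Finset.sum_neg_distrib, mul_neg]

theorem abs_avg_le (f : X → ℝ) : |avg f| ≤ avg fun x => |f x| := by
  rw [abs_le, ← avg_neg]
  exact ⟨avg_mono fun x => neg_abs_le _, avg_mono fun x => le_abs_self _⟩

theorem abs_avg_sub_le [Nonempty X] {f g : X → ℝ} {ε : ℝ} (h : ∀ x, |f x - g x| ≤ ε) :
    |avg f - avg g| ≤ ε := by
  rw [← avg_sub]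
  exact (abs_avg_le _).trans ((avg_mono h).trans_eq (avg_const ε))

theorem avg_nonneg {f : X → ℝ} (h : ∀ x, 0 ≤ f x) : 0 ≤ avg f := by
  let _ := Fintype.ofFinite X
  rw [avg_eq ‹_›]
  exact mul_nonneg (by positivity) (Finset.sum_nonneg fun x _ => h x)

theorem avg_le_one [Nonempty X] {f : X → ℝ} (h : ∀ x, f x ≤ 1) : avg f ≤ 1 :=
  (avg_mono h).trans_eq (avg_const 1)

theorem avg_comm (f : X → Y → ℝ) :
    (avg fun x => avg fun y => f x y) = avg fun y => avg fun x => f x y := by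
  let _ := Fintype.ofFinite X
  let _ := Fintype.ofFinite Y
  simp only [avg_eq ‹Fintype X›, avg_eq ‹Fintype Y›, Finset.mul_sum]
  rw [Finset.sum_comm]
  refine Finset.sum_congr rfl fun y _ => Finset.sum_congr rfl fun x _ => ?_
  ring

theorem avg_equiv (e : X ≃ Y) (f : Y → ℝ) : (avg fun x => f (e x)) = avg f := by
  let _ := Fintype.ofFinite X
  let _ := Fintype.ofFinite Y
  rw [avg_eq ‹_›, avg_eq ‹_›, Fintype.card_congr e, Equiv.sum_comp e f]

theorem avg_prod (f : X × Y → ℝ) : avg f = avg fun x => avg fun y => f (x, y) := by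
  let _ := Fintype.ofFinite X
  let _ := Fintype.ofFinite Y
  simp only [avg_eq ‹Fintype X›, avg_eq ‹Fintype Y›, avg_eq (inferInstance : Fintype (X × Y)),
    Finset.mul_sum, Fintype.card_prod, Fintype.sum_prod_type, Nat.cast_mul]
  refine Finset.sum_congr rfl fun y _ => Finset.sum_congr rfl fun x _ => ?_
  rw [mul_inv]
  ring

/-- A surjective homomorphism maps the uniform distribution to the uniform distribution. -/
theorem avg_addHom {G H : Type} [Finite G] [Finite H] [AddGroup G] [AddGroup H] (φ : G → H)
    (hadd : ∀ x y, φ (x + y) = φ x + φ y) (hφ : Function.Surjective φ) (f : H → ℝ) :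
    (avg fun g => f (φ g)) = avg f := by
  obtain ⟨s, hs⟩ := hφ.hasRightInverse
  calc (avg fun g => f (φ g)) = avg fun _ : H => avg fun g => f (φ g) := (avg_const _).symm
    _ = avg fun h => avg fun g => f (φ (g + s h)) := by
      congr 1
      funext h
      exact (avg_equiv (Equiv.addRight (s h)) fun g => f (φ g)).symm
    _ = avg fun g => avg fun h => f (φ g + h) := by
      rw [avg_comm]
      simp only [hadd, hs _]
    _ = avg fun _ : G => avg f := by
      congr 1
      funext g
      exact avg_equiv (Equiv.addLeft (φ g)) f
    _ = avg f := avg_const _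

end avg

theorem unif_bind_toReal {X Y : Type} [Finite X] [Nonempty X] (f : X → PMF Y) (y : Y) :
    ((unif X).bind f y).toReal = avg fun x => (f x y).toReal := by
  let _ := Fintype.ofFinite X
  rw [avg_eq ‹_›, PMF.bind_apply, tsum_fintype, ENNReal.toReal_sum, Finset.mul_sum]
  · refine Finset.sum_congr rfl fun x _ => ?_
    rw [ENNReal.toReal_mul]
    congr 1
    simp [unif]
  · exact fun x _ => ENNReal.mul_ne_top (PMF.apply_ne_top _ _) (PMF.apply_ne_top _ _)

/-- The probability that `D` accepts the input `s`. -/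
def Adversary.acc (D : Adversary) (lam : ℕ) (s : List Bool) : ℝ :=
  (D.run lam noOracle s true).toReal

theorem Adversary.acc_nonneg (D : Adversary) (lam : ℕ) (s : List Bool) : 0 ≤ D.acc lam s :=
  ENNReal.toReal_nonneg

theorem Adversary.acc_le_one (D : Adversary) (lam : ℕ) (s : List Bool) : D.acc lam s ≤ 1 :=
  ENNReal.toReal_le_of_le_ofReal zero_le_one (by simpa using PMF.coe_le_one _ _)

theorem abs_sub_le_one {x y : ℝ} (hx : 0 ≤ x) (hx' : x ≤ 1) (hy : 0 ≤ y) (hy' : y ≤ 1) :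
    |x - y| ≤ 1 := by
  rw [abs_le]
  constructor <;> linarith

theorem exists_le_two_mul {X : Type} [Nonempty X] (f : X → ℝ) (h0 : ∀ x, 0 ≤ f x)
    (h1 : ∀ x, f x ≤ 1) : ∃ x, ∀ y, f y ≤ 2 * f x := by
  have hb : BddAbove (Set.range f) := ⟨1, by rintro _ ⟨x, rfl⟩; exact h1 x⟩
  by_cases hs : 0 < ⨆ x, f x
  · obtain ⟨x, hx⟩ := exists_lt_of_lt_ciSup (half_lt_self hs)
    exact ⟨x, fun y => (le_ciSup hb y).trans (by linarith)⟩
  · exact ⟨Classical.arbitrary X, fun y => (le_ciSup hb y).trans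
      ((not_lt.1 hs).trans (by linarith [h0 (Classical.arbitrary X)]))⟩

/-! ## Security against tests whose input bits are computed by formulas -/

/-- The advantage of `D`, applied to bits that the formulas `Fs` compute from the answers at the
points `r h`. -/
def formulaGap {L : Type} [Finite L] (eL : BitEncoding L) {K R : Type} [Finite K] [Finite R]
    {N m : ℕ} (Φ : K → R → Fin N → L) (D : Adversary) (lam : ℕ) (r : Fin m → R)
    (Fs : List (Form (Fin m × Fin N × Fin eL.len))) : ℝ :=
  |(avg fun k : K => D.acc lam (Fs.map (Form.eval (bitEnv eL fun h => Φ k (r h))))) -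
    avg fun U : R → Fin N → L => D.acc lam (Fs.map (Form.eval (bitEnv eL fun h => U (r h))))|

theorem IsSecurePRF.formulaGap_le {L : Type} [Finite L] [Nonempty L] {eL : BitEncoding L}
    {K R : ℕ → Type} [∀ lam, Finite (K lam)] [∀ lam, Nonempty (K lam)] [∀ lam, Finite (R lam)]
    {eR : ∀ lam, BitEncoding (R lam)} {N : ℕ → ℕ} {Φ : ∀ lam, K lam → R lam → Fin (N lam) → L}
    (hΦ : IsSecurePRF eL eR Φ) (hR : PolyBounded fun lam => (eR lam).len) {D : Adversary}
    (hD : D.PolyTime) {B : ℕ → ℕ} (hB : PolyBounded B) :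
    ∃ ε : ℕ → ℝ, Negligible ε ∧ ∀ lam (m : ℕ) (r : Fin m → R lam)
      (Fs : List (Form (Fin m × Fin (N lam) × Fin eL.len))), m ≤ B lam →
      (Fs.map fun f => f.size + 3).sum ≤ B lam → formulaGap eL (Φ lam) D lam r Fs ≤ ε lam := by
  let T : ℕ → Type := fun lam => {d : Σ m : ℕ, (Fin m → R lam) ×
    List (Form (Fin m × Fin (N lam) × Fin eL.len)) //
      d.1 ≤ B lam ∧ (d.2.2.map fun f => f.size + 3).sum ≤ B lam}
  have hT : ∀ lam, Nonempty (T lam) := fun lam => ⟨⟨⟨0, Fin.elim0, []⟩, by simp⟩⟩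
  have hmax : ∀ lam, ∃ d : T lam, ∀ d' : T lam,
      formulaGap eL (Φ lam) D lam d'.1.2.1 d'.1.2.2 ≤
        2 * formulaGap eL (Φ lam) D lam d.1.2.1 d.1.2.2 := fun lam =>
    exists_le_two_mul (fun d : T lam => formulaGap eL (Φ lam) D lam d.1.2.1 d.1.2.2)
      (fun d => abs_nonneg _) fun d => abs_sub_le_one (avg_nonneg fun _ => D.acc_nonneg _ _)
        (avg_le_one fun _ => D.acc_le_one _ _) (avg_nonneg fun _ => D.acc_nonneg _ _)
        (avg_le_one fun _ => D.acc_le_one _ _)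
  choose d hd using hmax
  choose C hC hC' using fun lam =>
    exists_oracle_circuit (eR lam) eL (d lam).1.2.1 (D.circ lam) (D.coins lam) (d lam).1.2.2
  let A : Adversary := ⟨D.coins, C⟩
  have hA : A.PolyTime := by
    have hb : PolyBounded fun lam => 2 + B lam * (1 + (eR lam).len) + (B lam +
        (D.coins lam + (D.circ lam).size) * 4) + (D.coins lam + (D.circ lam).size) +
        (D.coins lam + (D.circ lam).size) :=
      ((((PolyBounded.const 2).add (hB.mul ((PolyBounded.const 1).add hR))).add
        (hB.add (hD.mul (PolyBounded.const 4)))).add hD).add hD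
    refine hb.mono fun lam => ?_
    have h1 := hC lam
    obtain ⟨h2, h3⟩ := (d lam).2
    have h4 := Nat.mul_le_mul_right (1 + (eR lam).len) h2
    simp only [A]
    omega
  have hrun : ∀ lam (f : R lam → Fin (N lam) → L), (A.run lam (oracleOf (eR lam) eL f) [] true).toReal =
      D.acc lam ((d lam).1.2.2.map
        (Form.eval (bitEnv eL fun h => f ((d lam).1.2.1 h)))) := by
    intro lam f
    rw [Adversary.acc]
    congr 2
    unfold Adversary.run
    congr 1
    funext c
    rw [List.nil_append]
    exact congrArg (fun l => l.headD false) (hC' lam f c)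
  refine ⟨_, (hΦ A hA).const_mul zero_le_two, fun lam m r Fs hm hFs => ?_⟩
  refine (hd lam ⟨⟨m, r, Fs⟩, hm, hFs⟩).trans_eq ?_
  rw [advantage, unif_bind_toReal, unif_bind_toReal]
  simp only [hrun]
  rfl

/-! ## Functions whose bits are computed by formulas -/

theorem exists_form_entry {L : Type} (eL : BitEncoding L) {m N : ℕ} (h : Fin m) (c : Fin N)
    (ψ : L → Bool) : ∃ f : Form (Fin m × Fin N × Fin eL.len),
      f.size = Form.tableSize eL.len ∧ ∀ y, f.eval (bitEnv eL y) = ψ (y h c) := by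
  classical
  refine ⟨Form.table ((List.finRange eL.len).map fun b => (h, c, b)) fun l =>
    if hl : ∃ z, eL.bits z = l then ψ hl.choose else false, ?_, fun y => ?_⟩
  · rw [Form.size_table, List.length_map, List.length_finRange]
  · have hl : ((List.finRange eL.len).map fun b => (h, c, b)).map (bitEnv eL y) =
        eL.bits (y h c) := by
      refine List.ext_getElem (by simp [eL.length_bits]) fun i h1 h2 => ?_
      simp [bitEnv, List.getElem?_eq_getElem h2]
    have hex : ∃ z, eL.bits z = eL.bits (y h c) := ⟨_, rfl⟩
    rw [Form.eval_table, hl, dif_pos hex, eL.injective hex.choose_spec]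

/-- The bits of `g y` are computed by formulas of size at most `C` from the bits of `y`. -/
def ByFormulas {L : Type} (eL : BitEncoding L) (C : ℕ) {m N : ℕ}
    (g : (Fin m → Fin N → L) → List Bool) : Prop :=
  ∃ Fs : List (Form (Fin m × Fin N × Fin eL.len)), (∀ f ∈ Fs, f.size ≤ C) ∧
    ∀ y, Fs.map (Form.eval (bitEnv eL y)) = g y

namespace ByFormulas

variable {L : Type} {eL : BitEncoding L} {C m N : ℕ}

theorem const (hC : 1 ≤ C) (l : List Bool) :
    ByFormulas eL C fun _ : Fin m → Fin N → L => l := by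
  refine ⟨l.map Form.const, fun f hf => ?_, fun y => ?_⟩
  · obtain ⟨b, -, rfl⟩ := List.mem_map.1 hf
    exact hC
  · simp [Function.comp_def, Form.eval]

theorem append {g g' : (Fin m → Fin N → L) → List Bool} (hg : ByFormulas eL C g)
    (hg' : ByFormulas eL C g') : ByFormulas eL C fun y => g y ++ g' y := by
  obtain ⟨Fs, h, he⟩ := hg
  obtain ⟨Fs', h', he'⟩ := hg'
  refine ⟨Fs ++ Fs', fun f hf => ?_, fun y => by rw [List.map_append, he, he']⟩
  rcases List.mem_append.1 hf with hf | hf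
  exacts [h f hf, h' f hf]

theorem flatMap {X : Type} (l : List X) {g : X → (Fin m → Fin N → L) → List Bool}
    (hg : ∀ x, ByFormulas eL C (g x)) : ByFormulas eL C fun y => l.flatMap fun x => g x y := by
  induction l with
  | nil => exact ⟨[], by simp, by simp⟩
  | cons x l ih => exact (hg x).append ih

theorem entry (h : Fin m) (c : Fin N) (γ : L → L) :
    ByFormulas eL (Form.tableSize eL.len) fun y => eL.bits (γ (y h c)) := by
  choose f hf he using fun b : Fin eL.len =>
    exists_form_entry eL (m := m) h c fun z => (eL.bits (γ z)).getD b false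
  refine ⟨(List.finRange eL.len).map f, fun F hF => ?_, fun y => ?_⟩
  · obtain ⟨b, -, rfl⟩ := List.mem_map.1 hF
    exact (hf b).le
  · refine List.ext_getElem (by simp [eL.length_bits]) fun i h1 h2 => ?_
    have h3 : i < (eL.bits (γ (y h c))).length := h2
    simp [he, List.getElem?_eq_getElem h3]

end ByFormulas

theorem Form.one_le_tableSize (d : ℕ) : 1 ≤ Form.tableSize d := by
  cases d <;> simp [tableSize]

/-- A secure PRF, evaluated at prescribed points, is indistinguishable from a random function, for
tests that transform each value by formulas of bounded size; uniformly in all the data. -/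
theorem IsSecurePRF.gap_le {L : Type} [Finite L] [Nonempty L] {eL : BitEncoding L}
    {K R : ℕ → Type} [∀ lam, Finite (K lam)] [∀ lam, Nonempty (K lam)] [∀ lam, Finite (R lam)]
    {eR : ∀ lam, BitEncoding (R lam)} {N : ℕ → ℕ} {Φ : ∀ lam, K lam → R lam → Fin (N lam) → L}
    (hΦ : IsSecurePRF eL eR Φ) (hR : PolyBounded fun lam => (eR lam).len) {D : Adversary}
    (hD : D.PolyTime) {B : ℕ → ℕ} (hB : PolyBounded B) (C : ℕ) :
    ∃ ε : ℕ → ℝ, Negligible ε ∧ ∀ lam (m : ℕ) (r : Fin m → R lam)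
      (g : (Fin m → Fin (N lam) → L) → List Bool), m ≤ B lam → ByFormulas eL C g →
      (∀ y, (g y).length ≤ B lam) →
      |(avg fun k => D.acc lam (g fun h => Φ lam k (r h))) -
        avg fun U : R lam → Fin (N lam) → L => D.acc lam (g fun h => U (r h))| ≤ ε lam := by
  obtain ⟨ε, hε, h⟩ := hΦ.formulaGap_le hR hD
    (hB.mul ((PolyBounded.const C).add (PolyBounded.const 3)) |>.add hB)
  refine ⟨ε, hε, fun lam m r g hm hg hl => ?_⟩
  obtain ⟨Fs, hs, he⟩ := hg
  have h1 := h lam m r Fs (hm.trans (by omega)) ?_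
  · simpa only [formulaGap, he] using h1
  · have h2 := hl fun _ _ => Classical.arbitrary L
    rw [← he, List.length_map] at h2
    have h3 : (Fs.map fun f => f.size + 3).sum ≤ Fs.length * (C + 3) := by
      refine (List.sum_le_card_nsmul _ (C + 3) fun x hx => ?_).trans (by simp)
      obtain ⟨f, hf, rfl⟩ := List.mem_map.1 hx
      exact Nat.add_le_add_right (hs f hf) 3
    exact (h3.trans (Nat.mul_le_mul_right _ h2)).trans (by omega)

/-- The adversary that outputs its first input bit. -/
def firstBit : Adversary := ⟨fun _ => 0, fun _ => ⟨[], [0]⟩⟩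

theorem firstBit_acc (lam : ℕ) (b : Bool) : firstBit.acc lam [b] = if b then 1 else 0 := by
  have : firstBit.run lam noOracle [b] = PMF.pure b := by
    have h : (fun c : Fin (firstBit.coins lam) → Bool => ((firstBit.circ lam).eval noOracle
        ([b] ++ List.ofFn c)).headD false) = Function.const _ b := by
      funext c
      rw [Function.const_apply]
      simp [firstBit, Circuit.eval]
    rw [Adversary.run, h, PMF.map_const]
  rw [Adversary.acc, this]
  cases b <;> simp

theorem avg_eq_indicator {X : Type} [Finite X] [DecidableEq X] (x : X) :
    (avg fun y => if y = x then (1 : ℝ) else 0) = (Nat.card X : ℝ)⁻¹ := by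
  let _ := Fintype.ofFinite X
  rw [avg_eq ‹_›, Nat.card_eq_fintype_card]
  simp

/-- The key space of a PRF for which the zero key gives the zero function is large. -/
theorem IsSecurePRF.inv_card_le {L : Type} [Finite L] [Field L] {eL : BitEncoding L}
    {K R : ℕ → Type} [∀ lam, Finite (K lam)] [∀ lam, Field (K lam)] [∀ lam, Finite (R lam)]
    {eR : ∀ lam, BitEncoding (R lam)} {N : ℕ → ℕ} {Φ : ∀ lam, K lam → R lam → Fin (N lam) → L}
    (hΦ : IsSecurePRF eL eR Φ) (hR : PolyBounded fun lam => (eR lam).len)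
    (hN : PolyBounded N) (hlam : ∀ lam, lam ≤ N lam) (h0 : ∀ lam r, Φ lam 0 r = 0) :
    ∃ ε : ℕ → ℝ, Negligible ε ∧ ∀ lam, Nonempty (R lam) → (Nat.card (K lam) : ℝ)⁻¹ ≤ ε lam := by
  classical
  have hD : firstBit.PolyTime := (PolyBounded.const 1).mono fun lam => by
    simp [firstBit, Circuit.size]
  obtain ⟨ε, hε, h⟩ := hΦ.formulaGap_le hR hD
    ((hN.mul (PolyBounded.const (Form.tableSize eL.len + 3))).add (PolyBounded.const 4))
  refine ⟨_, hε.add negligible_one_div_two_pow, fun lam ⟨r⟩ => ?_⟩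
  choose f hf he using fun c : Fin (N lam) =>
    exists_form_entry eL (m := 1) 0 c fun z => decide (z = 0)
  have h1 := h lam 1 (fun _ => r) [Form.all ((List.finRange (N lam)).map f)] (by omega) (by
    have := Form.size_all (l := (List.finRange (N lam)).map f) (C := Form.tableSize eL.len)
      fun F hF => by
        obtain ⟨c, -, rfl⟩ := List.mem_map.1 hF
        exact (hf c).le
    rw [List.length_map, List.length_finRange] at this
    simp only [List.map_cons, List.map_nil, List.sum_cons, List.sum_nil]
    omega)
  have hev : ∀ y : Fin 1 → Fin (N lam) → L,
      firstBit.acc lam (([Form.all ((List.finRange (N lam)).map f)]).map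
        (Form.eval (bitEnv eL y))) = if y 0 = 0 then 1 else 0 := by
    intro y
    rw [List.map_cons, List.map_nil, firstBit_acc]
    refine if_congr ?_ rfl rfl
    rw [Form.eval_all, funext_iff]
    simp [he]
  simp only [formulaGap, hev] at h1
  have h2 : (avg fun U : R lam → Fin (N lam) → L => if U r = 0 then (1 : ℝ) else 0) ≤
      1 / 2 ^ lam := by
    rw [avg_addHom (fun U : R lam → Fin (N lam) → L => U r) (fun _ _ => rfl)
      (fun y => ⟨fun _ => y, rfl⟩) fun y => if y = 0 then (1 : ℝ) else 0, avg_eq_indicator,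
      Nat.card_fun, Nat.card_eq_fintype_card (α := Fin (N lam)), Fintype.card_fin, one_div]
    have h3 : 2 ≤ Nat.card L := Finite.one_lt_card
    have h4 : (2 : ℝ) ^ lam ≤ ((Nat.card L ^ N lam : ℕ) : ℝ) := by
      exact_mod_cast (Nat.pow_le_pow_right (by norm_num) (hlam lam)).trans
        (Nat.pow_le_pow_left h3 _)
    gcongr
  have h3 : (Nat.card (K lam) : ℝ)⁻¹ ≤
      avg fun k : K lam => if Φ lam k r = 0 then (1 : ℝ) else 0 := by
    rw [← avg_eq_indicator (0 : K lam)]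
    refine avg_mono fun k => ?_
    by_cases hk : k = 0
    · simp [hk, h0]
    · rw [if_neg hk]
      split_ifs <;> norm_num
  have h4 := (abs_le.1 h1).2
  linarith

/-! ## Polynomials with prescribed values -/

theorem isUnit_vandermonde {k : Type} [Field k] {t : ℕ} {x : Fin t → k}
    (hx : Function.Injective x) : IsUnit (Matrix.vandermonde x) := by
  rw [Matrix.isUnit_iff_isUnit_det, isUnit_iff_ne_zero]
  exact Matrix.det_vandermonde_ne_zero_iff.2 hx

theorem vandermonde_mulVec {k : Type} [Field k] {t : ℕ} (x : Fin t → k) (c : Fin t → k)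
    (i : Fin t) : (Matrix.vandermonde x).mulVec c i = polyVal c (x i) := by
  simp [Matrix.mulVec, dotProduct, polyVal, Matrix.vandermonde_apply, mul_comm]

theorem polyVal_bijective {k O : Type} [Field k] [Fintype O] {t : ℕ} (hO : Fintype.card O = t)
    {x : O → k} (hx : Function.Injective x) :
    Function.Bijective fun (c : Fin t → k) o => polyVal c (x o) := by
  let e : Fin t ≃ O := (Fintype.equivFinOfCardEq hO).symm
  have hu := isUnit_vandermonde (hx.comp e.injective)
  have h1 := Matrix.mulVec_injective_iff_isUnit.2 hu
  have h2 := Matrix.mulVec_surjective_iff_isUnit.2 hu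
  constructor
  · intro c c' h
    refine h1 (funext fun i => ?_)
    rw [vandermonde_mulVec, vandermonde_mulVec]
    exact congrFun h (e i)
  · intro y
    obtain ⟨c, hc⟩ := h2 fun i => y (e i)
    refine ⟨c, funext fun o => ?_⟩
    have := congrFun hc (e.symm o)
    rw [vandermonde_mulVec] at this
    simpa using this

theorem exists_interpolation_coeffs {𝔽 O : Type} [Field 𝔽] [Fintype O] {t : ℕ}
    (hO : Fintype.card O = t) {x : O → 𝔽} (hx : Function.Injective x) (z : 𝔽) :
    ∃ w : O → 𝔽, ∀ d : Fin t, ∑ o, w o * x o ^ (d : ℕ) = z ^ (d : ℕ) := by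
  let e : Fin t ≃ O := (Fintype.equivFinOfCardEq hO).symm
  have hu := isUnit_vandermonde (hx.comp e.injective)
  obtain ⟨w, hw⟩ := Matrix.vecMul_surjective_iff_isUnit.2 hu fun d => z ^ (d : ℕ)
  refine ⟨fun o => w (e.symm o), fun d => ?_⟩
  rw [← congrFun hw d, ← e.sum_comp]
  simp [Matrix.vecMul, dotProduct, Matrix.vandermonde_apply]

section sharing

/-- The points of the secret and of the parties in `S`. -/
def sharePoint {n : ℕ} {𝔽 : Type} (ι : Fin (n + 1) → 𝔽) (S : Finset (Fin n)) : Option S → 𝔽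
  | none => ι 0
  | some s => ι (s : Fin n).succ

theorem sharePoint_injective {n : ℕ} {𝔽 : Type} {ι : Fin (n + 1) → 𝔽}
    (hι : Function.Injective ι) (S : Finset (Fin n)) : Function.Injective (sharePoint ι S) := by
  rintro (_ | s) (_ | s') h
  · rfl
  · exact absurd (hι h) (Fin.succ_ne_zero _).symm
  · exact absurd (hι h) (Fin.succ_ne_zero _)
  · rw [Subtype.ext (Fin.succ_injective _ (hι h))]

variable {n t : ℕ} {𝔽 : Type} [Field 𝔽] (ι : Fin (n + 1) → 𝔽)

/-- The coefficients `A`, `B` express the shares of all parties by the secret and the shares of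
the parties in `S`. -/
structure IsShareCoeffs (t : ℕ) (S : Finset (Fin n)) (A : Fin n → 𝔽) (B : Fin n → S → 𝔽) :
    Prop where
  zero_of_mem : ∀ i ∈ S, A i = 0
  polyVal_eq : ∀ {k : Type} [Field k] [Algebra 𝔽 k] (c : Fin t → k) (i : Fin n),
    polyVal c (algebraMap 𝔽 k (ι i.succ)) = A i • polyVal c (algebraMap 𝔽 k (ι 0)) +
      ∑ s, B i s • polyVal c (algebraMap 𝔽 k (ι (s : Fin n).succ))

variable {ι}

theorem exists_isShareCoeffs (hι : Function.Injective ι) {S : Finset (Fin n)}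
    (hS : S.card + 1 = t) : ∃ A B, IsShareCoeffs ι t S A B := by
  classical
  have hO : Fintype.card (Option S) = t := by simp [hS]
  have h : ∀ i : Fin n, ∃ w : Option S → 𝔽, (i ∈ S → w none = 0) ∧
      ∀ d : Fin t, ∑ o, w o * sharePoint ι S o ^ (d : ℕ) = ι i.succ ^ (d : ℕ) := by
    intro i
    by_cases hi : i ∈ S
    · refine ⟨fun o => if o = some ⟨i, hi⟩ then 1 else 0, fun _ => by simp, fun d => ?_⟩
      simp [sharePoint]
    · obtain ⟨w, hw⟩ := exists_interpolation_coeffs hO (sharePoint_injective hι S) (ι i.succ)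
      exact ⟨w, fun h => absurd h hi, hw⟩
  choose w h0 hw using h
  refine ⟨fun i => w i none, fun i s => w i (some s), h0, fun {k} _ _ c i => ?_⟩
  have hd : ∀ d : Fin t, c d * algebraMap 𝔽 k (ι i.succ) ^ (d : ℕ) =
      algebraMap 𝔽 k (w i none) * (c d * algebraMap 𝔽 k (ι 0) ^ (d : ℕ)) +
        ∑ s : S, algebraMap 𝔽 k (w i (some s)) *
          (c d * algebraMap 𝔽 k (ι (s : Fin n).succ) ^ (d : ℕ)) := by
    intro d
    rw [← map_pow, ← hw i, Fintype.sum_option, map_add, map_sum, mul_add, Finset.mul_sum]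
    simp only [sharePoint, map_mul, map_pow]
    congr 1
    · ring
    · exact Finset.sum_congr rfl fun s _ => by ring
  simp only [polyVal, Algebra.smul_def, hd, Finset.sum_add_distrib, Finset.mul_sum]
  rw [Finset.sum_comm (s := (Finset.univ : Finset (Fin t)))]

/-- Given the secrets, the shares of `t - 1` parties determine the sharing polynomials, and are
arbitrary. -/
def sharesEquiv (hι : Function.Injective ι) {S : Finset (Fin n)} (hS : S.card + 1 = t)
    {k I : Type} [Field k] [Algebra 𝔽 k] (s : I → k) :
    SharingPolys t (algebraMap 𝔽 k (ι 0)) s ≃ (I → S → k) :=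
  have hO : Fintype.card (Option S) = t := by simp [hS]
  have hb := polyVal_bijective hO
    ((algebraMap 𝔽 k).injective.comp (sharePoint_injective hι S))
  Equiv.ofBijective (fun c i j => polyVal (c.1 i) (algebraMap 𝔽 k (ι (j : Fin n).succ))) <| by
    constructor
    · intro c c' h
      refine Subtype.ext (funext fun i => hb.1 (funext fun o => ?_))
      rcases o with _ | j
      · exact (c.2 i).trans (c'.2 i).symm
      · exact congrFun (congrFun h i) j
    · intro y
      choose c hc using fun i => hb.2 fun o => Option.elim o (s i) (y i)
      exact ⟨⟨c, fun i => congrFun (hc i) none⟩, funext fun i => funext fun j =>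
        congrFun (hc i) (some j)⟩

theorem sharesEquiv_apply (hι : Function.Injective ι) {S : Finset (Fin n)} (hS : S.card + 1 = t)
    {k I : Type} [Field k] [Algebra 𝔽 k] {s : I → k}
    (c : SharingPolys t (algebraMap 𝔽 k (ι 0)) s) (i : I) (j : S) :
    sharesEquiv hι hS s c i j = polyVal (c.1 i) (algebraMap 𝔽 k (ι (j : Fin n).succ)) := rfl

theorem interpolateSecret_polyVal {L : Type} [Field L] [Algebra 𝔽 L]
    (hι : Function.Injective ι) {party : Fin t → Fin n} (hp : Function.Injective party)
    (c : Fin t → L) {y : Fin t → L}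
    (hy : ∀ i, y i = polyVal c (algebraMap 𝔽 L (ι (party i).succ))) :
    interpolateSecret ι party y = polyVal c (algebraMap 𝔽 L (ι 0)) := by
  let p : Polynomial L := ∑ d : Fin t, Polynomial.C (c d) * Polynomial.X ^ (d : ℕ)
  have hev : ∀ x, p.eval x = polyVal c x := fun x => by
    simp [p, Polynomial.eval_finsetSum, polyVal]
  have hdeg : p.degree < t := Polynomial.degree_sum_fin_lt c
  rw [interpolateSecret, ← hev, Lagrange.eq_interpolate_of_eval_eq (s := Finset.univ)
    (v := fun i => algebraMap 𝔽 L (ι (party i).succ)) (f := p) y]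
  · exact fun i _ j _ h =>
      hp (Fin.succ_injective _ (hι ((algebraMap 𝔽 L).injective h)))
  · simpa using hdeg
  · exact fun i _ => by rw [hev, hy]

end sharing

/-! ## Changes of variables for linearly independent families -/

section transvection

variable {k V I : Type} [Field k] [AddCommGroup V] [Module k V] [Fintype I] [DecidableEq I]

theorem LinearIndependent.transvection {κ : I → V} (h : LinearIndependent k κ) {p : I}
    {d : I → k} (hd : d p = 0) :
    LinearIndependent k fun q => κ q + if q = p then ∑ i, d i • κ i else 0 := by
  rw [Fintype.linearIndependent_iff] at h ⊢
  intro g hg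
  have h1 : ∑ q, (g q + g p * d q) • κ q = 0 := by
    rw [← hg]
    simp only [add_smul, smul_add, mul_smul, Finset.sum_add_distrib, Finset.smul_sum,
      smul_ite, smul_zero, Finset.sum_ite_eq', Finset.mem_univ, if_true]
  have hp : g p = 0 := by simpa [hd] using h _ h1 p
  intro q
  simpa [hp] using h _ h1 q

theorem transvection_comp {p : I} {d : I → k} (hd : d p = 0) (κ : I → V) (q : I) :
    (fun q => κ q + if q = p then ∑ i, d i • κ i else 0) q +
      (if q = p then ∑ i, (-d i) • (fun q => κ q + if q = p then ∑ i, d i • κ i else 0) i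
        else 0) = κ q := by
  by_cases hq : q = p
  · have : ∑ i, (-d i) • (κ i + if i = p then ∑ i, d i • κ i else 0) =
        -∑ i, d i • κ i := by
      simp [smul_add, Finset.sum_add_distrib, hd]
    simp only [if_pos hq, this]
    abel
  · simp [hq]

/-- A bijection of the set of linearly independent families that carries one linear combination
to another one and changes few entries. -/
theorem exists_equiv_linearIndependent {w w' : I → k} {p p' : I} (hw : w p = 1)
    (hw' : w' p' = 1) : ∃ T : (I → V) ≃ (I → V),
      (∀ κ, LinearIndependent k κ ↔ LinearIndependent k (T κ)) ∧
      (∀ κ q, q ≠ p → q ≠ p' → T κ q = κ q) ∧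
      ∀ κ, ∑ q, w' q • T κ q = ∑ q, w q • κ q := by
  let d : I → k := fun q => w (Equiv.swap p p' q) - w' q
  have hd : d p' = 0 := by simp [d, hw, hw']
  have hd' : (fun q => -d q) p' = 0 := by simp [hd]
  let E : (I → V) ≃ (I → V) :=
    { toFun := fun κ q => κ q + if q = p' then ∑ i, d i • κ i else 0
      invFun := fun κ q => κ q + if q = p' then ∑ i, (-d i) • κ i else 0
      left_inv := fun κ => funext fun q => transvection_comp hd κ q
      right_inv := fun κ => funext fun q => by
        simpa using transvection_comp (d := fun q => -d q) hd' κ q }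
  refine ⟨(Equiv.arrowCongr (Equiv.swap p p') (Equiv.refl V)).trans E, fun κ => ?_,
    fun κ q h1 h2 => ?_, fun κ => ?_⟩
  · have h1 : LinearIndependent k κ ↔ LinearIndependent k (κ ∘ Equiv.swap p p') :=
      (linearIndependent_equiv (Equiv.swap p p')).symm
    rw [h1]
    refine ⟨fun h => ?_, fun h => ?_⟩
    · simpa [E, Equiv.arrowCongr, Function.comp_def] using h.transvection hd
    · have h2 := h.transvection (d := fun q => -d q) hd'
      have h3 := E.left_inv (κ ∘ Equiv.swap p p')
      rw [← h3]
      simpa [E, Equiv.arrowCongr, Function.comp_def] using h2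
  · simp [E, Equiv.arrowCongr, h2, Equiv.swap_apply_of_ne_of_ne h1 h2]
  · have : ∀ κ' : I → V, ∑ q, w' q • E κ' q = ∑ q, w (Equiv.swap p p' q) • κ' q := by
      intro κ'
      simp only [E, Equiv.coe_fn_mk, smul_add, smul_ite, smul_zero, Finset.sum_add_distrib,
        Finset.sum_ite_eq', Finset.mem_univ, if_true, hw', one_smul, d, sub_smul,
        Finset.sum_sub_distrib]
      abel
    rw [Equiv.trans_apply, this, ← Equiv.sum_comp (Equiv.swap p p')]
    simp [Equiv.arrowCongr]

end transvection

/-! ## Correctness -/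

theorem PMF.bind_eq_of_forall {X Y : Type} {p : PMF X} {f : X → PMF Y} {q : PMF Y}
    (h : ∀ x, f x = q) : p.bind f = q := by
  rw [funext h, PMF.bind_const]

section correctness

variable {n t ℓ N : ℕ} {𝔽 L K R : Type} [Field 𝔽] [Field L] [Field K] [Algebra 𝔽 L] [Algebra 𝔽 K]

theorem polyVal_add {k : Type} [Field k] (c c' : Fin t → k) (x : k) :
    polyVal (c + c') x = polyVal c x + polyVal c' x := by
  simp [polyVal, add_mul, Finset.sum_add_distrib]

theorem polyVal_sum {k I : Type} [Field k] (s : Finset I) (c : I → Fin t → k) (x : k) :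
    polyVal (∑ i ∈ s, c i) x = ∑ i ∈ s, polyVal (c i) x := by
  simp only [polyVal, Finset.sum_apply, Finset.sum_mul]
  exact Finset.sum_comm

/-- `𝔽`-linearity in the key. -/
structure IsKeyLinear (𝔽 : Type) {L K R : Type} [Field 𝔽] [Field L] [Field K] [Algebra 𝔽 L]
    [Algebra 𝔽 K] {N : ℕ} (Φ : K → R → Fin N → L) : Prop where
  map_add : ∀ k₁ k₂ r, Φ (k₁ + k₂) r = Φ k₁ r + Φ k₂ r
  map_smul : ∀ (c : 𝔽) k r, Φ (c • k) r = c • Φ k r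

namespace IsKeyLinear

variable {Φ : K → R → Fin N → L}

theorem map_zero (hΦ : IsKeyLinear 𝔽 Φ) (r : R) : Φ 0 r = 0 := by
  simpa using hΦ.map_smul 0 0 r

theorem map_sum (hΦ : IsKeyLinear 𝔽 Φ) {I : Type} (s : Finset I) (k : I → K) (r : R) :
    Φ (∑ i ∈ s, k i) r = ∑ i ∈ s, Φ (k i) r := by
  classical
  induction s using Finset.induction_on with
  | empty => simpa using hΦ.map_zero r
  | insert i s hi ih => rw [Finset.sum_insert hi, Finset.sum_insert hi, hΦ.map_add, ih]

theorem polyVal_eq (hΦ : IsKeyLinear 𝔽 Φ) (c : Fin t → K) (z : 𝔽) (r : R) (h : Fin N) :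
    Φ (polyVal c (algebraMap 𝔽 K z)) r h =
      polyVal (fun d => Φ (c d) r h) (algebraMap 𝔽 L z) := by
  have : ∀ d, c d * algebraMap 𝔽 K z ^ (d : ℕ) = z ^ (d : ℕ) • c d := fun d => by
    rw [Algebra.smul_def, map_pow, mul_comm]
  simp only [polyVal, this, hΦ.map_sum, Finset.sum_apply, hΦ.map_smul, Pi.smul_apply]
  refine Finset.sum_congr rfl fun d _ => ?_
  rw [Algebra.smul_def, map_pow, mul_comm]

end IsKeyLinear

/-- The key share of party `i`, from the results of all random choices. -/
def shamirKey (ι : Fin (n + 1) → 𝔽) (a : Fin ℓ → Bool) (v : Idx ℓ × Fin N → L)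
    (rp : Idx ℓ × Fin N → Fin t → L) (αp : Idx ℓ → Fin t → L) (κ : Fin n × Idx ℓ → K)
    (kp : Fin n × Idx ℓ → Fin t → K) (i : Fin n) : ShamirKey n ℓ N L K where
  party := i
  v := fun j h => polyVal (rp (j, h)) (algebraMap 𝔽 L (ι i.succ))
  θ := fun h => ∑ j, v ((j, a j), h)
  α := fun j => polyVal (αp j) (algebraMap 𝔽 L (ι i.succ))
  ownKeys := fun j => κ (i, j)
  keyShares := fun i' j => polyVal (kp (i', j)) (algebraMap 𝔽 K (ι i.succ))
  keySum := ∑ i', ∑ j, κ (i', (j, a j))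

open Classical in
theorem shamirRec_eq (ht : 1 ≤ t) {ι : Fin (n + 1) → 𝔽} (hι : Function.Injective ι)
    {Φ : K → R → Fin (N + 1) → L} (hΦ : IsKeyLinear 𝔽 Φ) (a : Fin ℓ → Bool)
    {v : Idx ℓ × Fin N → L} (rp : SharingPolys t (algebraMap 𝔽 L (ι 0)) v)
    {αv : Idx ℓ → L} (αp : SharingPolys t (algebraMap 𝔽 L (ι 0)) αv)
    {κ : Fin n × Idx ℓ → K} (kp : SharingPolys t (algebraMap 𝔽 K (ι 0)) κ)
    (e : Fin t ↪ Fin n) (x : Fin ℓ → Bool) (r : R) :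
    shamirRec ht ι Φ (fun i =>
        shamirEval Φ (shamirKey ι a v rp.1 αp.1 κ kp.1 (e i)) x r) =
      if (fun h => ∑ j, (v ((j, x j), h) - v ((j, a j), h))) =
          prfFst Φ (∑ i, ∑ j, κ (i, (j, a j))) r - prfFst Φ (∑ i, ∑ j, κ (i, (j, x j))) r
      then ∑ j, αv (j, x j) + prfSnd Φ (∑ i, ∑ j, κ (i, (j, x j))) r -
        prfSnd Φ (∑ i, ∑ j, κ (i, (j, a j))) r
      else 0 := by
  have hval : ∀ (c : Idx ℓ → Fin t → L) (h : Fin (N + 1)) (z : 𝔽),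
      ∑ j, (polyVal (c (j, x j)) (algebraMap 𝔽 L z) +
        ∑ l, Φ (polyVal (kp.1 (l, (j, x j))) (algebraMap 𝔽 K z)) r h) =
      polyVal (∑ j, (c (j, x j) + ∑ l, fun d => Φ (kp.1 (l, (j, x j)) d) r h))
        (algebraMap 𝔽 L z) := by
    intro c h z
    simp only [polyVal_sum, polyVal_add, hΦ.polyVal_eq]
  have h0 : ∀ h, interpolateSecret ι e (fun i => (shamirEval Φ
      (shamirKey ι a v rp.1 αp.1 κ kp.1 (e i)) x r).s₀ h) =
      ∑ j, v ((j, x j), h) + prfFst Φ (∑ i, ∑ j, κ (i, (j, x j))) r h := by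
    intro h
    rw [interpolateSecret_polyVal hι e.injective
      (∑ j, (rp.1 ((j, x j), h) + ∑ l, fun d => Φ (kp.1 (l, (j, x j)) d) r h.castSucc))
      fun i => ?_]
    · rw [← hval (fun j => rp.1 (j, h)), Finset.sum_add_distrib]
      simp only [rp.2, kp.2, prfFst, hΦ.map_sum, Finset.sum_apply]
      rw [Finset.sum_comm]
    · rw [← hval (fun j => rp.1 (j, h))]
      simp [shamirEval, shamirKey, prfFst, Finset.sum_apply]
  have h1 : interpolateSecret ι e (fun i => (shamirEval Φ
      (shamirKey ι a v rp.1 αp.1 κ kp.1 (e i)) x r).s₁) =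
      ∑ j, αv (j, x j) + prfSnd Φ (∑ i, ∑ j, κ (i, (j, x j))) r := by
    rw [interpolateSecret_polyVal hι e.injective
      (∑ j, (αp.1 (j, x j) + ∑ l, fun d => Φ (kp.1 (l, (j, x j)) d) r (Fin.last N)))
      fun i => ?_]
    · rw [← hval αp.1, Finset.sum_add_distrib]
      simp only [αp.2, kp.2, prfSnd, hΦ.map_sum, Finset.sum_apply]
      rw [Finset.sum_comm]
    · rw [← hval αp.1]
      simp [shamirEval, shamirKey, prfSnd]
  unfold shamirRec
  dsimp only
  change (if (fun h => interpolateSecret ι e (fun i => (shamirEval Φ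
      (shamirKey ι a v rp.1 αp.1 κ kp.1 (e i)) x r).s₀ h)) =
      (fun h => ∑ j, v ((j, a j), h)) + prfFst Φ (∑ i', ∑ j, κ (i', (j, a j))) r then
    interpolateSecret ι e (fun i => (shamirEval Φ
      (shamirKey ι a v rp.1 αp.1 κ kp.1 (e i)) x r).s₁) -
      prfSnd Φ (∑ i', ∑ j, κ (i', (j, a j))) r else 0) = _
  simp only [h0, h1]
  refine if_congr ?_ rfl rfl
  simp only [funext_iff, Pi.add_apply, Pi.sub_apply, Finset.sum_sub_distrib]
  refine forall_congr' fun h => ?_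
  rw [sub_eq_sub_iff_add_eq_add, add_comm (prfFst _ _ _ _)]

variable [Finite L] [Finite K]

theorem shamirRec_at (ht : 1 ≤ t) (hℓ : 1 ≤ ℓ) {ι : Fin (n + 1) → 𝔽}
    (hι : Function.Injective ι) (k₀ : Subfield 𝔽)
    (hK : ∃ κ : Fin n × Idx ℓ → K, LinearIndependent k₀ κ)
    {Φ : K → R → Fin (N + 1) → L} (hΦ : IsKeyLinear 𝔽 Φ) (a : Fin ℓ → Bool) (α : L)
    (e : Fin t ↪ Fin n) (r : R) :
    ((shamirGen (N := N) ht hℓ ι k₀ hK a α).map fun f =>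
      shamirRec ht ι Φ fun i => shamirEval Φ (f (e i)) a r) = PMF.pure α := by
  classical
  simp only [shamirGen, PMF.map_bind, PMF.pure_map]
  refine PMF.bind_eq_of_forall fun v => PMF.bind_eq_of_forall fun rp =>
    PMF.bind_eq_of_forall fun αv => PMF.bind_eq_of_forall fun αp =>
    PMF.bind_eq_of_forall fun κ => PMF.bind_eq_of_forall fun kp => ?_
  refine congrArg PMF.pure ((shamirRec_eq ht hι hΦ a rp αp kp e a r).trans ?_)
  rw [if_pos (by funext h; simp), αv.2]
  ring

theorem shamirRec_off (ht : 1 ≤ t) (hℓ : 1 ≤ ℓ) {ι : Fin (n + 1) → 𝔽}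
    (hι : Function.Injective ι) (k₀ : Subfield 𝔽)
    (hK : ∃ κ : Fin n × Idx ℓ → K, LinearIndependent k₀ κ)
    {Φ : K → R → Fin (N + 1) → L} (hΦ : IsKeyLinear 𝔽 Φ) (a : Fin ℓ → Bool) (α : L)
    (e : Fin t ↪ Fin n) (x : Fin ℓ → Bool) (hx : x ≠ a) (r : R) :
    1 - (Nat.card (Fin N → L) : ℝ)⁻¹ ≤ (((shamirGen (N := N) ht hℓ ι k₀ hK a α).map fun f =>
      shamirRec ht ι Φ fun i => shamirEval Φ (f (e i)) x r) 0).toReal := by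
  classical
  have : Nonempty {κ : Fin n × Idx ℓ → K // LinearIndependent k₀ κ} :=
    hK.elim fun κ hκ => ⟨⟨κ, hκ⟩⟩
  let δ : (Idx ℓ × Fin N → L) → Fin N → L := fun v h => ∑ j, (v ((j, x j), h) - v ((j, a j), h))
  let c : (Fin n × Idx ℓ → K) → Fin N → L := fun κ =>
    prfFst Φ (∑ i, ∑ j, κ (i, (j, a j))) r - prfFst Φ (∑ i, ∑ j, κ (i, (j, x j))) r
  have hδ : Function.Surjective δ := by
    obtain ⟨j₀, hj⟩ := Function.ne_iff.1 hx
    intro y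
    refine ⟨fun q => if q.1 = (j₀, x j₀) then y q.2 else 0, funext fun h => ?_⟩
    have : ∀ j, ((if ((j, x j) : Idx ℓ) = (j₀, x j₀) then y h else 0) -
        if ((j, a j) : Idx ℓ) = (j₀, x j₀) then y h else 0) = if j = j₀ then y h else 0 := by
      intro j
      by_cases hjj : j = j₀
      · subst hjj
        simp [Ne.symm hj]
      · simp [hjj]
    simp only [δ, this, Finset.sum_ite_eq', Finset.mem_univ, if_true]
  have hmain : 1 - (Nat.card (Fin N → L) : ℝ)⁻¹ = avg fun v => avg
      fun κ : {κ : Fin n × Idx ℓ → K // LinearIndependent k₀ κ} =>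
        1 - if δ v = c κ.1 then (1 : ℝ) else 0 := by
    rw [avg_comm]
    have : ∀ κ : {κ : Fin n × Idx ℓ → K // LinearIndependent k₀ κ},
        (avg fun v => 1 - if δ v = c κ.1 then (1 : ℝ) else 0) =
          1 - (Nat.card (Fin N → L) : ℝ)⁻¹ := by
      intro κ
      rw [avg_sub, avg_const, avg_addHom δ (fun v w => ?_) hδ
        fun y => if y = c κ.1 then (1 : ℝ) else 0, avg_eq_indicator]
      funext h
      simp only [δ, Pi.add_apply, ← Finset.sum_add_distrib]
      exact Finset.sum_congr rfl fun j _ => by ring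
    simp only [this, avg_const]
  rw [hmain]
  simp only [shamirGen, PMF.map_bind, PMF.pure_map, unif_bind_toReal]
  refine avg_mono fun v => ?_
  have := nonempty_sharingPolys ht (algebraMap 𝔽 L (ι 0)) v
  have := nonempty_splittings hℓ a α
  rw [← avg_const (X := SharingPolys t (algebraMap 𝔽 L (ι 0)) v) (avg _)]
  refine avg_mono fun rp => ?_
  rw [← avg_const (X := {αv : Idx ℓ → L // ∑ j, αv (j, a j) = α}) (avg _)]
  refine avg_mono fun αv => ?_
  have := nonempty_sharingPolys ht (algebraMap 𝔽 L (ι 0)) αv.1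
  rw [← avg_const (X := SharingPolys t (algebraMap 𝔽 L (ι 0)) αv.1) (avg _)]
  refine avg_mono fun αp => avg_mono fun κ => ?_
  have := nonempty_sharingPolys ht (algebraMap 𝔽 K (ι 0)) κ.1
  rw [← avg_const (X := SharingPolys t (algebraMap 𝔽 K (ι 0)) κ.1) (_ - _)]
  refine avg_mono fun kp => ?_
  have hrec := shamirRec_eq ht hι hΦ a rp αp kp e x r
  by_cases h : δ v = c κ.1
  · rw [if_pos h, sub_self]
    exact ENNReal.toReal_nonneg
  · rw [if_neg h, sub_zero]
    have hz := hrec.trans (if_neg h)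
    change 1 ≤ ((PMF.pure (shamirRec ht ι Φ fun i =>
      shamirEval Φ (shamirKey ι a v rp.1 αp.1 κ.1 kp.1 (e i)) x r)) 0).toReal
    rw [hz]
    simp

end correctness

/-! ## Key generation in terms of the shares of few parties, and perfect secrecy -/

theorem unif_apply {X : Type} [Finite X] [Nonempty X] (x : X) :
    unif X x = (Nat.card X : ENNReal)⁻¹ := by
  let _ := Fintype.ofFinite X
  rw [Nat.card_eq_fintype_card]
  simp [unif]

theorem unif_bind_equiv {X Y Z : Type} [Finite X] [Nonempty X] [Finite Y] [Nonempty Y]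
    (e : X ≃ Y) (g : Y → PMF Z) : (unif X).bind (fun x => g (e x)) = (unif Y).bind g := by
  ext z
  simp only [PMF.bind_apply, unif_apply, Nat.card_congr e]
  exact e.tsum_eq fun y => (Nat.card Y : ENNReal)⁻¹ * g y z

section secrecy

variable {n t ℓ N : ℕ} {𝔽 L K : Type} [Field 𝔽] [Field L] [Field K] [Algebra 𝔽 L] [Algebra 𝔽 K]
  {S : Finset (Fin n)}

/-- The sum of the vectors selected by `a`. -/
def selectVec (a : Fin ℓ → Bool) (v : Idx ℓ × Fin N → L) : Fin N → L :=
  fun h => ∑ j, v ((j, a j), h)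

theorem selectVec_surjective (hℓ : 1 ≤ ℓ) (a : Fin ℓ → Bool) :
    Function.Surjective (selectVec (L := L) (N := N) a) := by
  classical
  intro y
  refine ⟨fun q => if q.1.1 = ⟨0, hℓ⟩ then y q.2 else 0, funext fun h => ?_⟩
  simp [selectVec]

/-- The sum of the keys selected by `a`. -/
def selectKey (a : Fin ℓ → Bool) (κ : Fin n × Idx ℓ → K) : K := ∑ i, ∑ j, κ (i, (j, a j))

/-- The key share of party `i`, in terms of the secrets and the shares of the parties in `S`. -/
def shareKey (A : Fin n → 𝔽) (B : Fin n → S → 𝔽) (v : Idx ℓ × Fin N → L)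
    (σv : Idx ℓ × Fin N → S → L) (θ : Fin N → L) (αv : Idx ℓ → L) (σα : Idx ℓ → S → L)
    (κ : Fin n × Idx ℓ → K) (σκ : Fin n × Idx ℓ → S → K) (k : K) (i : Fin n) :
    ShamirKey n ℓ N L K where
  party := i
  v := fun j h => A i • v (j, h) + ∑ s, B i s • σv (j, h) s
  θ := θ
  α := fun j => A i • αv j + ∑ s, B i s • σα j s
  ownKeys := fun j => κ (i, j)
  keyShares := fun i' j => A i • κ (i', j) + ∑ s, B i s • σκ (i', j) s
  keySum := k

theorem shareKey_congr {A : Fin n → 𝔽} {B : Fin n → S → 𝔽} {i : Fin n} (hA : A i = 0)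
    {v v' : Idx ℓ × Fin N → L} {σv : Idx ℓ × Fin N → S → L} {θ : Fin N → L}
    {αv αv' : Idx ℓ → L} {σα : Idx ℓ → S → L} {κ κ' : Fin n × Idx ℓ → K}
    {σκ : Fin n × Idx ℓ → S → K} {k : K} (hκ : ∀ j, κ (i, j) = κ' (i, j)) :
    shareKey A B v σv θ αv σα κ σκ k i = shareKey A B v' σv θ αv' σα κ' σκ k i := by
  simp only [shareKey, hA, zero_smul, hκ]

/-- A bijection of the choices of linearly independent keys that exchanges `a` and `b` and does not
touch the keys of the parties different from `i₀`. -/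
theorem exists_keyEquiv (hℓ : 1 ≤ ℓ) (k₀ : Subfield 𝔽) (a b : Fin ℓ → Bool) (i₀ : Fin n) :
    ∃ T : {κ : Fin n × Idx ℓ → K // LinearIndependent k₀ κ} ≃
        {κ : Fin n × Idx ℓ → K // LinearIndependent k₀ κ},
      (∀ κ i j, i ≠ i₀ → (T κ).1 (i, j) = κ.1 (i, j)) ∧
      ∀ κ, selectKey b (T κ).1 = selectKey a κ.1 := by
  classical
  let w : (Fin ℓ → Bool) → Fin n × Idx ℓ → k₀ := fun a q => if q.2.2 = a q.2.1 then 1 else 0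
  have hw : ∀ (a : Fin ℓ → Bool) (κ : Fin n × Idx ℓ → K), ∑ q, w a q • κ q = selectKey a κ := by
    intro a κ
    simp only [w, ite_smul, one_smul, zero_smul, Fintype.sum_prod_type, selectKey]
    exact Finset.sum_congr rfl fun i _ => Finset.sum_congr rfl fun j _ => by simp
  obtain ⟨T, hT, hT', hT''⟩ := exists_equiv_linearIndependent (V := K) (w := w a) (w' := w b)
    (p := (i₀, (⟨0, hℓ⟩, a ⟨0, hℓ⟩))) (p' := (i₀, (⟨0, hℓ⟩, b ⟨0, hℓ⟩))) (by simp [w])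
    (by simp [w])
  refine ⟨T.subtypeEquiv hT, fun κ i j hi => ?_, fun κ => ?_⟩
  · exact hT' κ.1 _ (fun h => hi (congrArg Prod.fst h)) fun h => hi (congrArg Prod.fst h)
  · rw [← hw, ← hw]
    exact hT'' κ.1

/-- The bijection of the choices of vectors that exchanges `a` and `b`. -/
def vecEquiv (a b : Fin ℓ → Bool) : (Idx ℓ × Fin N → L) ≃ (Idx ℓ × Fin N → L) where
  toFun v q := v ((q.1.1, xor q.1.2 (xor (a q.1.1) (b q.1.1))), q.2)
  invFun v q := v ((q.1.1, xor q.1.2 (xor (a q.1.1) (b q.1.1))), q.2)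
  left_inv v := by funext q; simp
  right_inv v := by funext q; simp

theorem selectVec_vecEquiv (a b : Fin ℓ → Bool) (v : Idx ℓ × Fin N → L) :
    selectVec b (vecEquiv a b v) = selectVec a v := by
  funext h
  refine Finset.sum_congr rfl fun j _ => ?_
  cases h1 : a j <;> cases h2 : b j <;> simp [vecEquiv, h1, h2]

variable [Finite L] [Finite K]

theorem shamirGen_eq {ι : Fin (n + 1) → 𝔽} (hι : Function.Injective ι) (ht : 1 ≤ t) (hℓ : 1 ≤ ℓ)
    (k₀ : Subfield 𝔽) (hK : ∃ κ : Fin n × Idx ℓ → K, LinearIndependent k₀ κ)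
    (a : Fin ℓ → Bool) (α : L) (hS : S.card + 1 = t) {A : Fin n → 𝔽} {B : Fin n → S → 𝔽}
    (hAB : IsShareCoeffs ι t S A B) [Nonempty {αv : Idx ℓ → L // ∑ j, αv (j, a j) = α}]
    [Nonempty {κ : Fin n × Idx ℓ → K // LinearIndependent k₀ κ}] :
    shamirGen (N := N) ht hℓ ι k₀ hK a α =
      (unif (Idx ℓ × Fin N → L)).bind fun v =>
      (unif (Idx ℓ × Fin N → S → L)).bind fun σv =>
      (unif {αv : Idx ℓ → L // ∑ j, αv (j, a j) = α}).bind fun αv =>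
      (unif (Idx ℓ → S → L)).bind fun σα =>
      (unif {κ : Fin n × Idx ℓ → K // LinearIndependent k₀ κ}).bind fun κ =>
      (unif (Fin n × Idx ℓ → S → K)).bind fun σκ =>
      PMF.pure fun i => shareKey A B v σv (selectVec a v) αv.1 σα κ.1 σκ (selectKey a κ.1) i := by
  dsimp only [shamirGen]
  congr 1; funext v
  have := nonempty_sharingPolys ht (algebraMap 𝔽 L (ι 0)) v
  rw [← unif_bind_equiv (sharesEquiv hι hS v)]
  congr 1; funext rp
  congr 1; funext αv
  have := nonempty_sharingPolys ht (algebraMap 𝔽 L (ι 0)) αv.1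
  rw [← unif_bind_equiv (sharesEquiv hι hS αv.1)]
  congr 1; funext αp
  congr 1; funext κ
  have := nonempty_sharingPolys ht (algebraMap 𝔽 K (ι 0)) κ.1
  rw [← unif_bind_equiv (sharesEquiv hι hS κ.1)]
  congr 1; funext kp
  congr 1; funext i
  simp only [shareKey, sharesEquiv_apply]
  congr 1
  · funext j h
    rw [hAB.polyVal_eq, rp.2]
  · funext j
    rw [hAB.polyVal_eq, αp.2]
  · funext i' j
    rw [hAB.polyVal_eq, kp.2]

theorem shamirGen_shares_eq {ι : Fin (n + 1) → 𝔽} (hι : Function.Injective ι) (ht : 1 ≤ t)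
    (htn : t ≤ n) (hℓ : 1 ≤ ℓ) (k₀ : Subfield 𝔽)
    (hK : ∃ κ : Fin n × Idx ℓ → K, LinearIndependent k₀ κ) (a b : Fin ℓ → Bool) (α β : L)
    (hS : S.card + 1 = t) :
    ((shamirGen (N := N) ht hℓ ι k₀ hK a α).map fun f (i : S) => f i) =
      (shamirGen (N := N) ht hℓ ι k₀ hK b β).map fun f (i : S) => f i := by
  obtain ⟨A, B, hAB⟩ := exists_isShareCoeffs hι hS
  have hκ : Nonempty {κ : Fin n × Idx ℓ → K // LinearIndependent k₀ κ} :=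
    hK.elim fun κ hκ => ⟨⟨κ, hκ⟩⟩
  have ha := nonempty_splittings hℓ a α
  have hb := nonempty_splittings hℓ b β
  obtain ⟨i₀, hi₀⟩ : ∃ i₀, i₀ ∉ S := by
    by_contra! h
    have : S = Finset.univ := Finset.eq_univ_of_forall h
    rw [this, Finset.card_univ, Fintype.card_fin] at hS
    omega
  obtain ⟨T, hT, hT'⟩ := exists_keyEquiv (K := K) hℓ k₀ a b i₀
  rw [shamirGen_eq hι ht hℓ k₀ hK a α hS hAB, shamirGen_eq hι ht hℓ k₀ hK b β hS hAB]
  simp only [PMF.map_bind, PMF.pure_map]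
  conv_rhs => rw [← unif_bind_equiv (vecEquiv (L := L) (N := N) a b)]
  congr 1; funext v
  congr 1; funext σv
  refine Eq.trans (PMF.bind_eq_of_forall (q := (unif (Idx ℓ → S → L)).bind fun σα =>
      (unif {κ : Fin n × Idx ℓ → K // LinearIndependent k₀ κ}).bind fun κ =>
      (unif (Fin n × Idx ℓ → S → K)).bind fun σκ => PMF.pure fun i : S =>
        shareKey A B 0 σv (selectVec a v) 0 σα κ.1 σκ (selectKey a κ.1) i) fun αv => ?_)
    (Eq.symm (PMF.bind_eq_of_forall fun αv => ?_))
  · congr 1; funext σα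
    congr 1; funext κ
    congr 1; funext σκ
    refine congrArg PMF.pure (funext fun i => ?_)
    exact shareKey_congr (hAB.zero_of_mem _ i.2) fun _ => rfl
  · congr 1; funext σα
    rw [← unif_bind_equiv T]
    congr 1; funext κ
    congr 1; funext σκ
    refine congrArg PMF.pure (funext fun i => ?_)
    rw [hT' κ, selectVec_vecEquiv]
    exact shareKey_congr (hAB.zero_of_mem _ i.2) fun j =>
      hT κ _ j fun h => hi₀ (h ▸ i.2)

end secrecy

/-! ## Replacing distributions -/

/-- Independent samples of `F` can be replaced by uniform values one after the other. -/
theorem abs_avg_pi_sub_le {X Y : Type} [Finite X] [Nonempty X] [Finite Y] [Nonempty Y] (F : X → Y)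
    {ε : ℝ} {d : ℕ} (Ψ : (Fin d → Y) → ℝ)
    (h : ∀ W p, |(avg fun x => Ψ (Function.update W p (F x))) -
      avg fun y => Ψ (Function.update W p y)| ≤ ε) :
    |(avg fun x : Fin d → X => Ψ fun j => F (x j)) - avg Ψ| ≤ d * ε := by
  induction d with
  | zero =>
    have h1 : (fun x : Fin 0 → X => Ψ fun j => F (x j)) = fun _ => Ψ Fin.elim0 := by
      funext x; congr 1; exact Subsingleton.elim _ _
    have h2 : Ψ = fun _ => Ψ Fin.elim0 := by
      funext x; congr 1; exact Subsingleton.elim _ _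
    rw [h1, avg_const, h2, avg_const]
    simp
  | succ d ih =>
    have hc : ∀ (x : X) (W : Fin d → X), (fun j => F ((Fin.consEquiv fun _ => X) (x, W) j)) =
        Fin.cons (F x) fun j => F (W j) := fun x W => by
      funext j
      refine Fin.cases ?_ (fun j => ?_) j <;> simp [Fin.consEquiv]
    have e1 : (avg fun x : Fin (d + 1) → X => Ψ fun j => F (x j)) =
        avg fun x => avg fun W : Fin d → X => Ψ (Fin.cons (F x) fun j => F (W j)) := by
      rw [← avg_equiv (Fin.consEquiv fun _ => X), avg_prod]
      simp only [hc]
    have e2 : avg Ψ = avg fun y => avg fun W : Fin d → Y => Ψ (Fin.cons y W) := by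
      rw [← avg_equiv (Fin.consEquiv fun _ => Y), avg_prod]
      rfl
    have s1 : |(avg fun x => avg fun W : Fin d → X => Ψ (Fin.cons (F x) fun j => F (W j))) -
        avg fun x => avg fun W : Fin d → Y => Ψ (Fin.cons (F x) W)| ≤ d * ε :=
      abs_avg_sub_le fun x => ih (fun W => Ψ (Fin.cons (F x) W)) fun W p => by
        simpa only [Fin.cons_update] using h (Fin.cons (F x) W) p.succ
    have s2 : |(avg fun x => avg fun W : Fin d → Y => Ψ (Fin.cons (F x) W)) -
        avg fun y => avg fun W : Fin d → Y => Ψ (Fin.cons y W)| ≤ ε := by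
      rw [avg_comm, avg_comm (fun y (W : Fin d → Y) => Ψ (Fin.cons y W))]
      refine abs_avg_sub_le fun W => ?_
      simpa only [Fin.update_cons_zero] using h (Fin.cons (Classical.arbitrary Y) W) 0
    rw [e1, e2]
    refine (abs_sub_le _ _ _).trans ((add_le_add s1 s2).trans_eq ?_)
    push_cast
    ring

open Classical in
theorem abs_avg_subtype_sub_le {X : Type} [Finite X] {p : X → Prop} [Nonempty {x // p x}]
    {ψ : X → ℝ} (h0 : ∀ x, 0 ≤ ψ x) (h1 : ∀ x, ψ x ≤ 1) :
    |(avg fun x : {x // p x} => ψ x) - avg ψ| ≤ avg fun x => if p x then (0 : ℝ) else 1 := by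
  let _ := Fintype.ofFinite X
  have hX : Nonempty X := ‹Nonempty {x // p x}›.map Subtype.val
  set M := avg fun x : {x // p x} => ψ x with hM
  set q := avg fun x => if p x then (0 : ℝ) else 1 with hq
  have hM0 : 0 ≤ M := avg_nonneg fun _ => h0 _
  have hM1 : M ≤ 1 := avg_le_one fun _ => h1 _
  have hq0 : 0 ≤ q := avg_nonneg fun x => by split_ifs <;> norm_num
  have hsub : ∀ f : X → ℝ, (∑ x, if p x then f x else 0) = ∑ x : {x // p x}, f x := by
    intro f
    rw [← Finset.sum_filter]
    exact (Finset.sum_subtype _ (by simp) f)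
  have hcard : (Fintype.card {x // p x} : ℝ) ≠ 0 := by
    exact_mod_cast Fintype.card_ne_zero
  have e1 : (avg fun x => if p x then ψ x else 0) =
      M * avg fun x => if p x then (1 : ℝ) else 0 := by
    rw [avg_eq ‹Fintype X›, avg_eq ‹Fintype X›, hsub, hsub fun _ => 1, hM,
      avg_eq (inferInstance : Fintype {x // p x})]
    simp only [Finset.sum_const, Finset.card_univ, nsmul_eq_mul, mul_one]
    field_simp
  have e2 : (avg fun x => if p x then (1 : ℝ) else 0) = 1 - q := by
    have h := avg_sub (X := X) (fun _ => 1) fun x => if p x then (0 : ℝ) else 1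
    rw [avg_const] at h
    rw [hq, ← h]
    congr 1
    funext x
    split_ifs <;> norm_num
  have e3 : (avg ψ - avg fun x => if p x then ψ x else 0) =
      avg fun x => if p x then 0 else ψ x := by
    rw [← avg_sub]
    congr 1
    funext x
    split_ifs <;> simp
  have h2 : 0 ≤ avg fun x => if p x then 0 else ψ x :=
    avg_nonneg fun x => by split_ifs; exacts [le_rfl, h0 x]
  have h3 : (avg fun x => if p x then 0 else ψ x) ≤ q :=
    avg_mono fun x => by split_ifs; exacts [le_rfl, h1 x]
  rw [e2] at e1
  have h4 : M * q ≤ q := mul_le_of_le_one_left hq0 hM1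
  have h5 : 0 ≤ M * q := mul_nonneg hM0 hq0
  rw [abs_le]
  constructor <;> linarith

theorem avg_sum {X I : Type} [Finite X] (s : Finset I) (f : I → X → ℝ) :
    (avg fun x => ∑ i ∈ s, f i x) = ∑ i ∈ s, avg (f i) := by
  let _ := Fintype.ofFinite X
  simp only [avg_eq ‹Fintype X›]
  rw [Finset.sum_comm, Finset.mul_sum]

open Classical in
/-- A union bound: random families are linearly independent with high probability. -/
theorem avg_not_linearIndependent_le {k V I : Type} [Field k] [Finite k] [AddCommGroup V]
    [Finite V] [Module k V] [Fintype I] :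
    (avg fun κ : I → V => if LinearIndependent k κ then (0 : ℝ) else 1) ≤
      Nat.card (I → k) * (Nat.card V : ℝ)⁻¹ := by
  let _ := Fintype.ofFinite k
  have h1 : ∀ κ : I → V, (if LinearIndependent k κ then (0 : ℝ) else 1) ≤
      ∑ g : I → k, if g ≠ 0 then (if ∑ i, g i • κ i = 0 then (1 : ℝ) else 0) else 0 := by
    intro κ
    have hnn : ∀ g : I → k, 0 ≤
        if g ≠ 0 then (if ∑ i, g i • κ i = 0 then (1 : ℝ) else 0) else 0 := fun g => by
      split_ifs <;> norm_num
    by_cases h : LinearIndependent k κ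
    · rw [if_pos h]
      exact Finset.sum_nonneg fun g _ => hnn g
    · rw [if_neg h]
      rw [Fintype.linearIndependent_iff] at h
      push Not at h
      obtain ⟨g, hg, i, hi⟩ := h
      have hg0 : g ≠ 0 := fun h => hi (congrFun h i)
      refine le_trans (le_of_eq ?_) (Finset.single_le_sum (fun g _ => hnn g) (Finset.mem_univ g))
      rw [if_pos hg0, if_pos hg]
  refine (avg_mono h1).trans ?_
  rw [avg_sum, Nat.card_eq_fintype_card, ← nsmul_eq_mul]
  refine Finset.sum_le_card_nsmul _ _ _ fun g _ => ?_
  by_cases hg : g = 0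
  · simp only [hg, ne_eq, not_true_eq_false, if_false, avg_const]
    positivity
  · simp only [ne_eq, hg, not_false_eq_true, if_true]
    obtain ⟨i, hi⟩ := Function.ne_iff.1 hg
    rw [avg_addHom (fun κ : I → V => ∑ i, g i • κ i)
      (fun x y => by simp [Finset.sum_add_distrib])
      (fun y => ⟨fun j => if j = i then (g i)⁻¹ • y else 0, ?_⟩)
      fun y => if y = 0 then (1 : ℝ) else 0, avg_eq_indicator]
    simp only [smul_ite, smul_zero, Finset.sum_ite_eq', Finset.mem_univ, if_true]
    exact smul_inv_smul₀ hi y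

/-- Sums of values of random functions at distinct points are uniform. -/
theorem avg_masked_sum {m ℓ : ℕ} {R G : Type} [Finite R] [Finite G] [AddCommGroup G]
    (J : Fin m → Fin ℓ → Prop) [∀ h, DecidablePred (J h)] (hJ : ∀ h, ∃ j, J h j) {r : Fin m → R}
    (hr : Function.Injective r) (base : Fin m → G) (Ψ : (Fin m → G) → ℝ) :
    (avg fun U : Fin ℓ → R → G =>
      Ψ fun h => base h + ∑ j, if J h j then U j (r h) else 0) = avg Ψ := by
  classical
  have h1 := avg_addHom (fun (U : Fin ℓ → R → G) (h : Fin m) =>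
    ∑ j, if J h j then U j (r h) else 0) (fun U U' => ?_) (fun y => ?_)
    fun u => Ψ (base + u)
  · exact h1.trans (avg_equiv (Equiv.addLeft base) Ψ)
  · funext h
    rw [Pi.add_apply, ← Finset.sum_add_distrib]
    refine Finset.sum_congr rfl fun j _ => ?_
    split_ifs <;> simp
  · choose jc hjc using hJ
    refine ⟨fun j r' => ∑ h, if r h = r' ∧ j = jc h then y h else 0, funext fun h => ?_⟩
    have : ∀ j, (∑ h', if r h' = r h ∧ j = jc h' then y h' else 0) =
        if j = jc h then y h else 0 := by
      intro j
      rw [Finset.sum_eq_single h (fun h' _ hne => if_neg fun hh => hne (hr hh.1)) (by simp)]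
      simp
    simp only [this]
    rw [Finset.sum_eq_single (jc h) (fun j _ hne => by simp [hne]) (by simp)]
    simp [hjc h]

/-! ## The view of the adversary at one security parameter -/

theorem length_idxList (ℓ : ℕ) : (idxList ℓ).length = ℓ * 2 :=
  length_flatMap_finRange _ fun _ => rfl

/-- The length of the bit representation of a key share. -/
def keyBitsLength (n ℓ N lenL lenK : ℕ) : ℕ :=
  n + ℓ * 2 * (N * lenL) + N * lenL + ℓ * 2 * lenL + ℓ * 2 * lenK + n * (ℓ * 2 * lenK) + lenK

theorem ShamirKey.length_bits {n ℓ N : ℕ} {L K : Type} (eL : BitEncoding L) (eK : BitEncoding K)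
    (f : ShamirKey n ℓ N L K) :
    (f.bits eL eK).length = keyBitsLength n ℓ N eL.len eK.len := by
  simp only [ShamirKey.bits, List.length_append, partyBits, List.length_ofFn, eL.length_vecBits,
    eK.length_bits, keyBitsLength]
  rw [length_flatMap_const _ _ fun j _ => eL.length_vecBits _,
    length_flatMap_const _ _ fun j _ => eL.length_bits _,
    length_flatMap_const _ _ fun j _ => eK.length_bits _,
    length_flatMap_finRange _ fun i => length_flatMap_const _ _ fun j _ => eK.length_bits _,
    length_idxList]

/-- The length of the bit representation of an output share. -/
def outBitsLength (n N lenL lenK lenR : ℕ) : ℕ :=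
  n + N * lenL + lenL + lenR + N * lenL + lenK

theorem ShamirOut.length_bits {n N : ℕ} {L K R : Type} (eL : BitEncoding L) (eK : BitEncoding K)
    (eR : BitEncoding R) (s : ShamirOut n N L K R) :
    (s.bits eL eK eR).length = outBitsLength n N eL.len eK.len eR.len := by
  simp only [ShamirOut.bits, List.length_append, partyBits, List.length_ofFn, eL.length_vecBits,
    eK.length_bits, eL.length_bits, eR.length_bits, outBitsLength]

section view

variable {n t ℓ N m : ℕ} {𝔽 L K R : Type} [Field 𝔽] [Field L] [Algebra 𝔽 L]

/-- The key shares of the parties in `S` and the output shares of all parties, as bits. -/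
def viewList (eL : BitEncoding L) (eK : BitEncoding K) (eR : BitEncoding R)
    (Φ : K → R → Fin (N + 1) → L) (S : Finset (Fin n)) (x : Fin m → Fin ℓ → Bool) (r : Fin m → R)
    (f : Fin n → ShamirKey n ℓ N L K) : List Bool :=
  (((List.finRange n).filter fun i => i ∈ S).flatMap fun i => (f i).bits eL eK) ++
    ((List.finRange n).flatMap fun i => (List.finRange m).flatMap fun h =>
      (shamirEval Φ (f i) (x h) (r h)).bits eL eK eR)

theorem length_viewList (eL : BitEncoding L) (eK : BitEncoding K) (eR : BitEncoding R)
    (Φ : K → R → Fin (N + 1) → L) (S : Finset (Fin n)) (x : Fin m → Fin ℓ → Bool) (r : Fin m → R)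
    (f : Fin n → ShamirKey n ℓ N L K) :
    (viewList eL eK eR Φ S x r f).length =
      ((List.finRange n).filter fun i => i ∈ S).length * keyBitsLength n ℓ N eL.len eK.len +
        n * (m * outBitsLength n N eL.len eK.len eR.len) := by
  rw [viewList, List.length_append,
    length_flatMap_const _ _ fun i _ => ShamirKey.length_bits eL eK (f i),
    length_flatMap_finRange _ fun i => length_flatMap_finRange _ fun h =>
      ShamirOut.length_bits eL eK eR _]

/-- The output shares as functions of the shared values `Y h`. -/
def outBitsOf (eL : BitEncoding L) (eK : BitEncoding K) (eR : BitEncoding R) (A : Fin n → 𝔽)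
    (Z : Fin n → Fin m → Fin (N + 1) → L) (r : Fin m → R) (θ : Fin N → L) (k : K)
    (Y : Fin m → Fin (N + 1) → L) : List Bool :=
  (List.finRange n).flatMap fun i => (List.finRange m).flatMap fun h =>
    ShamirOut.bits eL eK eR
      { party := i
        s₀ := fun c => A i • Y h c.castSucc + Z i h c.castSucc
        s₁ := A i • Y h (Fin.last N) + Z i h (Fin.last N)
        r := r h
        θ := θ
        keySum := k }

theorem length_outBitsOf (eL : BitEncoding L) (eK : BitEncoding K) (eR : BitEncoding R)
    (A : Fin n → 𝔽) (Z : Fin n → Fin m → Fin (N + 1) → L) (r : Fin m → R) (θ : Fin N → L) (k : K)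
    (Y : Fin m → Fin (N + 1) → L) :
    (outBitsOf eL eK eR A Z r θ k Y).length =
      n * (m * outBitsLength n N eL.len eK.len eR.len) := by
  rw [outBitsOf, length_flatMap_finRange _ fun i => length_flatMap_finRange _ fun h =>
      ShamirOut.length_bits eL eK eR _]

theorem byFormulas_outBitsOf (eL : BitEncoding L) (eK : BitEncoding K) (eR : BitEncoding R)
    (A : Fin n → 𝔽) (Z : Fin n → Fin m → Fin (N + 1) → L) (r : Fin m → R) (θ : Fin N → L) (k : K)
    (γ : Fin m → Fin (N + 1) → L → L) :
    ByFormulas eL (Form.tableSize eL.len) fun y : Fin m → Fin (N + 1) → L =>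
      outBitsOf eL eK eR A Z r θ k fun h c => γ h c (y h c) := by
  have hC := Form.one_le_tableSize eL.len
  refine ByFormulas.flatMap _ fun i => ByFormulas.flatMap _ fun h => ?_
  have h₀ : ByFormulas eL (Form.tableSize eL.len) fun y : Fin m → Fin (N + 1) → L =>
      eL.vecBits fun c : Fin N => A i • γ h c.castSucc (y h c.castSucc) + Z i h c.castSucc :=
    ByFormulas.flatMap _ fun c =>
      ByFormulas.entry h c.castSucc fun z => A i • γ h c.castSucc z + Z i h c.castSucc
  have h₁ := ByFormulas.entry (eL := eL) h (Fin.last N) fun z =>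
    A i • γ h (Fin.last N) z + Z i h (Fin.last N)
  exact (((((ByFormulas.const hC (partyBits i)).append h₀).append h₁).append
    (ByFormulas.const hC (eR.bits (r h)))).append (ByFormulas.const hC (eL.vecBits θ))).append
    (ByFormulas.const hC (eK.bits k))

variable [Field K] [Algebra 𝔽 K] {S' : Finset (Fin n)}

/-- The values selected by `x`, in `L ^ (N + 1)`. -/
def selectAll (x : Fin ℓ → Bool) (v : Idx ℓ × Fin N → L) (αv : Idx ℓ → L) : Fin (N + 1) → L :=
  Fin.snoc (α := fun _ => L) (selectVec x v) (∑ j, αv (j, x j))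

/-- The contribution of the shares of the parties in `S'` to the output share of party `i`. -/
def outOffset (Φ : K → R → Fin (N + 1) → L) (B : Fin n → S' → 𝔽) (σv : Idx ℓ × Fin N → S' → L)
    (σα : Idx ℓ → S' → L) (σκ : Fin n × Idx ℓ → S' → K) (i : Fin n) (x : Fin ℓ → Bool) (r : R) :
    Fin (N + 1) → L :=
  selectAll x (fun q => ∑ s, B i s • σv q s) (fun q => ∑ s, B i s • σα q s) +
    ∑ j, ∑ l, Φ (∑ s, B i s • σκ (l, (j, x j)) s) r

theorem shamirEval_shareKey {Φ : K → R → Fin (N + 1) → L} (hΦ : IsKeyLinear 𝔽 Φ)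
    (A : Fin n → 𝔽) (B : Fin n → S' → 𝔽) (v : Idx ℓ × Fin N → L)
    (σv : Idx ℓ × Fin N → S' → L) (θ : Fin N → L) (αv : Idx ℓ → L) (σα : Idx ℓ → S' → L)
    (κ : Fin n × Idx ℓ → K) (σκ : Fin n × Idx ℓ → S' → K) (k : K) (i : Fin n)
    (x : Fin ℓ → Bool) (r : R) :
    shamirEval Φ (shareKey A B v σv θ αv σα κ σκ k i) x r =
      { party := i
        s₀ := fun c => A i • (selectAll x v αv + Φ (selectKey x κ) r) c.castSucc +
          outOffset Φ B σv σα σκ i x r c.castSucc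
        s₁ := A i • (selectAll x v αv + Φ (selectKey x κ) r) (Fin.last N) +
          outOffset Φ B σv σα σκ i x r (Fin.last N)
        r := r
        θ := θ
        keySum := k } := by
  have hcomm : ∀ c, ∑ j, ∑ l, Φ (κ (l, (j, x j))) r c = Φ (selectKey x κ) r c := fun c => by
    simp only [selectKey, hΦ.map_sum, Finset.sum_apply]
    exact Finset.sum_comm
  simp only [shamirEval, shareKey]
  congr 1
  · funext c
    simp only [Finset.sum_apply, Pi.add_apply, prfFst, hΦ.map_add, hΦ.map_smul, Pi.smul_apply,
      Finset.sum_add_distrib, hcomm, outOffset, selectAll, Fin.snoc_castSucc, selectVec, smul_add,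
      ← Finset.smul_sum]
    abel
  · simp only [Finset.sum_apply, Pi.add_apply, prfSnd, hΦ.map_add, hΦ.map_smul, Pi.smul_apply,
      Finset.sum_add_distrib, hcomm, outOffset, selectAll, Fin.snoc_last, smul_add,
      ← Finset.smul_sum]
    abel

open Classical in
/-- The bits of the view in terms of the data that the parties in `S'` know, and the shared output
values `Y h`. -/
def simulatedView (eL : BitEncoding L) (eK : BitEncoding K) (eR : BitEncoding R)
    (Φ : K → R → Fin (N + 1) → L) (S : Finset (Fin n)) (A : Fin n → 𝔽) (B : Fin n → S' → 𝔽)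
    (x : Fin m → Fin ℓ → Bool) (r : Fin m → R)
    (σv : Idx ℓ × Fin N → S' → L) (σα : Idx ℓ → S' → L) (σκ : Fin n × Idx ℓ → S' → K)
    (θ : Fin N → L) (κS : S' → Idx ℓ → K) (k : K) (Y : Fin m → Fin (N + 1) → L) : List Bool :=
  (((List.finRange n).filter fun i => i ∈ S).flatMap fun i =>
    (shareKey A B 0 σv θ 0 σα (fun q => if h : q.1 ∈ S' then κS ⟨q.1, h⟩ q.2 else 0) σκ k i).bits
      eL eK) ++
  outBitsOf eL eK eR A (fun i h => outOffset Φ B σv σα σκ i (x h) (r h)) r θ k Y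

theorem viewList_shareKey (eL : BitEncoding L) (eK : BitEncoding K) (eR : BitEncoding R)
    {Φ : K → R → Fin (N + 1) → L} (hΦ : IsKeyLinear 𝔽 Φ) {S : Finset (Fin n)} (hS : S ⊆ S')
    {A : Fin n → 𝔽} (hA : ∀ i ∈ S', A i = 0) (B : Fin n → S' → 𝔽)
    (x : Fin m → Fin ℓ → Bool) (r : Fin m → R) (v : Idx ℓ × Fin N → L)
    (σv : Idx ℓ × Fin N → S' → L) (θ : Fin N → L) (αv : Idx ℓ → L) (σα : Idx ℓ → S' → L)
    (κ : Fin n × Idx ℓ → K) (σκ : Fin n × Idx ℓ → S' → K) (k : K) :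
    viewList eL eK eR Φ S x r (fun i => shareKey A B v σv θ αv σα κ σκ k i) =
      simulatedView eL eK eR Φ S A B x r σv σα σκ θ (fun i j => κ (i, j)) k
        fun h => selectAll (x h) v αv + Φ (selectKey (x h) κ) (r h) := by
  classical
  rw [viewList, simulatedView, outBitsOf]
  congr 1
  · refine List.flatMap_congr fun i hi => ?_
    have hi' : i ∈ S' := hS (by simpa using hi)
    rw [shareKey_congr (hA i hi') (v' := 0) (αv' := 0) fun j => ?_]
    simp [hi']
  · simp only [shamirEval_shareKey hΦ]

theorem byFormulas_simulatedView (eL : BitEncoding L) (eK : BitEncoding K) (eR : BitEncoding R)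
    (Φ : K → R → Fin (N + 1) → L) (S : Finset (Fin n)) (A : Fin n → 𝔽) (B : Fin n → S' → 𝔽)
    (x : Fin m → Fin ℓ → Bool) (r : Fin m → R)
    (σv : Idx ℓ × Fin N → S' → L) (σα : Idx ℓ → S' → L) (σκ : Fin n × Idx ℓ → S' → K)
    (θ : Fin N → L) (κS : S' → Idx ℓ → K) (k : K) (γ : Fin m → Fin (N + 1) → L → L) :
    ByFormulas eL (Form.tableSize eL.len) fun y : Fin m → Fin (N + 1) → L =>
      simulatedView eL eK eR Φ S A B x r σv σα σκ θ κS k fun h c => γ h c (y h c) :=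
  (ByFormulas.const (Form.one_le_tableSize _) _).append (byFormulas_outBitsOf ..)

theorem length_simulatedView_le (eL : BitEncoding L) (eK : BitEncoding K) (eR : BitEncoding R)
    (Φ : K → R → Fin (N + 1) → L) (S : Finset (Fin n)) (A : Fin n → 𝔽) (B : Fin n → S' → 𝔽)
    (x : Fin m → Fin ℓ → Bool) (r : Fin m → R)
    (σv : Idx ℓ × Fin N → S' → L) (σα : Idx ℓ → S' → L) (σκ : Fin n × Idx ℓ → S' → K)
    (θ : Fin N → L) (κS : S' → Idx ℓ → K) (k : K) (Y : Fin m → Fin (N + 1) → L) :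
    (simulatedView eL eK eR Φ S A B x r σv σα σκ θ κS k Y).length ≤
      n * keyBitsLength n ℓ N eL.len eK.len +
        n * (m * outBitsLength n N eL.len eK.len eR.len) := by
  rw [simulatedView, List.length_append, length_outBitsOf,
    length_flatMap_const _ _ fun i _ => ShamirKey.length_bits eL eK _]
  gcongr
  simpa using List.length_filter_le (fun i => decide (i ∈ S)) (List.finRange n)

/-- The differences of the sums of keys at the two values of each bit. -/
def keyDiff (a : Fin ℓ → Bool) (κ : Fin n × Idx ℓ → K) (j : Fin ℓ) : K :=
  ∑ i, (κ (i, (j, !a j)) - κ (i, (j, a j)))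

theorem selectKey_eq_add (a x : Fin ℓ → Bool) (κ : Fin n × Idx ℓ → K) :
    selectKey x κ = selectKey a κ + ∑ j, if x j ≠ a j then keyDiff a κ j else 0 := by
  rw [selectKey, selectKey, Finset.sum_comm, Finset.sum_comm (s := Finset.univ (α := Fin n)),
    ← Finset.sum_add_distrib]
  refine Finset.sum_congr rfl fun j _ => ?_
  split_ifs with h
  · rw [keyDiff, ← Finset.sum_add_distrib]
    refine Finset.sum_congr rfl fun i _ => ?_
    have : x j = !a j := by cases h1 : x j <;> cases h2 : a j <;> simp_all
    rw [this]
    ring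
  · rw [not_not.1 h, add_zero]

theorem selectKey_add (a : Fin ℓ → Bool) (κ κ' : Fin n × Idx ℓ → K) :
    selectKey a (κ + κ') = selectKey a κ + selectKey a κ' := by
  simp [selectKey, Finset.sum_add_distrib]

theorem keyDiff_add (a : Fin ℓ → Bool) (κ κ' : Fin n × Idx ℓ → K) :
    keyDiff a (κ + κ') = keyDiff a κ + keyDiff a κ' := by
  funext j
  simp only [keyDiff, Pi.add_apply, ← Finset.sum_add_distrib]
  exact Finset.sum_congr rfl fun i _ => by ring

theorem exists_keys (hℓ : 1 ≤ ℓ) {i₀ : Fin n} (hi₀ : i₀ ∉ S') (a : Fin ℓ → Bool)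
    (κS : S' → Idx ℓ → K) (k : K) (Δ : Fin ℓ → K) :
    ∃ κ : Fin n × Idx ℓ → K, (fun (i : S') j => κ (i, j)) = κS ∧ selectKey a κ = k ∧
      keyDiff a κ = Δ := by
  classical
  let κ₁ : Fin n × Idx ℓ → K := fun q => if h : q.1 ∈ S' then κS ⟨q.1, h⟩ q.2 else 0
  let κ₂ : Fin n × Idx ℓ → K := fun q => if q.1 = i₀ then
    (if q.2.1 = ⟨0, hℓ⟩ then k - selectKey a κ₁ else 0) +
      (if q.2.2 = a q.2.1 then 0 else Δ q.2.1 - keyDiff a κ₁ q.2.1) else 0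
  refine ⟨κ₁ + κ₂, ?_, ?_, ?_⟩
  · funext i j
    have : (i : Fin n) ≠ i₀ := fun h => hi₀ (h ▸ i.2)
    simp [κ₁, κ₂, this]
  · have : selectKey a κ₂ = k - selectKey a κ₁ := by
      rw [selectKey, Finset.sum_eq_single i₀ (fun i _ hi => by simp [κ₂, hi]) (by simp)]
      simp [κ₂]
    rw [selectKey_add, this]
    ring
  · have : keyDiff a κ₂ = Δ - keyDiff a κ₁ := by
      funext j
      rw [keyDiff, Finset.sum_eq_single i₀ (fun i _ hi => by simp [κ₂, hi]) (by simp)]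
      simp [κ₂]
    rw [keyDiff_add, this]
    abel

end view

/-! ## Multi-evaluation security -/

section multiEval

variable {n t ℓ N m : ℕ} {𝔽 L K R : Type} [Field 𝔽] [Field L] [Field K] [Algebra 𝔽 L]
  [Algebra 𝔽 K] [Finite L] [Finite K] [Finite R] {S' : Finset (Fin n)}

/-- The acceptance probability when the output values `Y h` are uniform. -/
def idealAcc (acc : List Bool → ℝ) (eL : BitEncoding L) (eK : BitEncoding K) (eR : BitEncoding R)
    (Φ : K → R → Fin (N + 1) → L) (S : Finset (Fin n)) (A : Fin n → 𝔽) (B : Fin n → S' → 𝔽)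
    (x : Fin m → Fin ℓ → Bool) (r : Fin m → R)
    (σv : Idx ℓ × Fin N → S' → L) (σα : Idx ℓ → S' → L) (θ : Fin N → L) : ℝ :=
  avg fun σκ => avg fun κS => avg fun k => avg fun Y =>
    acc (simulatedView eL eK eR Φ S A B x r σv σα σκ θ κS k Y)

/-- The average over uniform keys is an average over the keys of the parties in `S'`, the sum of
the selected keys, and the differences. -/
theorem avg_keys (hℓ : 1 ≤ ℓ) {i₀ : Fin n} (hi₀ : i₀ ∉ S') (a : Fin ℓ → Bool)
    (f : (S' → Idx ℓ → K) → K → (Fin ℓ → K) → ℝ) :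
    (avg fun κ : Fin n × Idx ℓ → K =>
      f (fun i j => κ (i, j)) (selectKey a κ) (keyDiff a κ)) =
      avg fun κS => avg fun k => avg fun Δ => f κS k Δ := by
  rw [avg_addHom (fun κ : Fin n × Idx ℓ → K =>
    ((fun (i : S') j => κ (i, j)), selectKey a κ, keyDiff a κ)) (fun κ κ' => ?_) ?_
    fun q : (S' → Idx ℓ → K) × K × (Fin ℓ → K) => f q.1 q.2.1 q.2.2, avg_prod]
  · simp only [avg_prod]
  · rintro ⟨κS, k, Δ⟩
    obtain ⟨κ, h1, h2, h3⟩ := exists_keys hℓ hi₀ a κS k Δ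
    exact ⟨κ, by rw [← h1, ← h2, ← h3]⟩
  · rw [selectKey_add, keyDiff_add]
    rfl

open Classical in
theorem abs_avg_view_sub_idealAcc_le {acc : List Bool → ℝ} (h0 : ∀ s, 0 ≤ acc s)
    (h1 : ∀ s, acc s ≤ 1) (eL : BitEncoding L) (eK : BitEncoding K) (eR : BitEncoding R)
    {Φ : K → R → Fin (N + 1) → L} (hΦ : IsKeyLinear 𝔽 Φ) (hℓ : 1 ≤ ℓ) {k₀ : Subfield 𝔽}
    [Nonempty {κ : Fin n × Idx ℓ → K // LinearIndependent k₀ κ}]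
    {S : Finset (Fin n)} {i₀ : Fin n} (hi₀ : i₀ ∉ S') (A : Fin n → 𝔽)
    (B : Fin n → S' → 𝔽) {a : Fin ℓ → Bool} {x : Fin m → Fin ℓ → Bool} (hx : ∀ h, x h ≠ a)
    {r : Fin m → R} (hr : Function.Injective r) {ε : ℝ}
    (hε : ∀ g : (Fin m → Fin (N + 1) → L) → List Bool,
      ByFormulas eL (Form.tableSize eL.len) g →
      (∀ y, (g y).length ≤ n * keyBitsLength n ℓ N eL.len eK.len +
        n * (m * outBitsLength n N eL.len eK.len eR.len)) →
      |(avg fun k => acc (g fun h => Φ k (r h))) -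
        avg fun U : R → Fin (N + 1) → L => acc (g fun h => U (r h))| ≤ ε)
    (v : Idx ℓ × Fin N → L) (σv : Idx ℓ × Fin N → S' → L) (αv : Idx ℓ → L)
    (σα : Idx ℓ → S' → L) (θ : Fin N → L) :
    |(avg fun κ : {κ : Fin n × Idx ℓ → K // LinearIndependent k₀ κ} => avg fun σκ =>
      acc (simulatedView eL eK eR Φ S A B x r σv σα σκ θ (fun i j => κ.1 (i, j))
        (selectKey a κ.1) fun h =>
          selectAll (x h) v αv + Φ (selectKey (x h) κ.1) (r h))) -
      idealAcc acc eL eK eR Φ S A B x r σv σα θ| ≤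
    (avg fun κ : Fin n × Idx ℓ → K => if LinearIndependent k₀ κ then (0 : ℝ) else 1) +
      ℓ * ε := by
  refine (abs_sub_le _ (avg fun κ : Fin n × Idx ℓ → K => avg fun σκ =>
      acc (simulatedView eL eK eR Φ S A B x r σv σα σκ θ (fun i j => κ (i, j))
        (selectKey a κ) fun h =>
          selectAll (x h) v αv + Φ (selectKey (x h) κ) (r h))) _).trans (add_le_add ?_ ?_)
  · exact abs_avg_subtype_sub_le (p := fun κ => LinearIndependent k₀ κ)
      (ψ := fun κ : Fin n × Idx ℓ → K => avg fun σκ =>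
      acc (simulatedView eL eK eR Φ S A B x r σv σα σκ θ (fun i j => κ (i, j))
        (selectKey a κ) fun h => selectAll (x h) v αv + Φ (selectKey (x h) κ) (r h)))
      (fun κ => avg_nonneg fun σκ => h0 _) fun κ => avg_le_one fun σκ => h1 _
  · rw [avg_comm, idealAcc]
    refine abs_avg_sub_le fun σκ => ?_
    simp only [fun h (κ : Fin n × Idx ℓ → K) => selectKey_eq_add a (x h) κ]
    rw [avg_keys hℓ hi₀ a fun κS k Δ => acc (simulatedView eL eK eR Φ S A B x r σv σα σκ θ κS k
      fun h => selectAll (x h) v αv +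
        Φ (k + ∑ j, if x h j ≠ a j then Δ j else 0) (r h))]
    refine abs_avg_sub_le fun κS => abs_avg_sub_le fun k => ?_
    let base : Fin m → Fin (N + 1) → L := fun h => selectAll (x h) v αv + Φ k (r h)
    let Ψ : (Fin ℓ → R → Fin (N + 1) → L) → ℝ := fun W =>
      acc (simulatedView eL eK eR Φ S A B x r σv σα σκ θ κS k fun h =>
        base h + ∑ j, if x h j ≠ a j then W j (r h) else 0)
    have e1 : (avg fun Δ : Fin ℓ → K => acc (simulatedView eL eK eR Φ S A B x r σv σα σκ θ κS k
        fun h => selectAll (x h) v αv +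
          Φ (k + ∑ j, if x h j ≠ a j then Δ j else 0) (r h))) =
        avg fun Δ : Fin ℓ → K => Ψ fun j => Φ (Δ j) := by
      congr 1
      funext Δ
      simp only [Ψ, base]
      congr 2
      funext h
      rw [hΦ.map_add, hΦ.map_sum, add_assoc]
      congr 2
      refine Finset.sum_congr rfl fun j _ => ?_
      split_ifs
      · rfl
      · exact hΦ.map_zero _
    have e2 : avg Ψ = avg fun Y => acc (simulatedView eL eK eR Φ S A B x r σv σα σκ θ κS k Y) :=
      avg_masked_sum (fun h j => x h j ≠ a j) (fun h => Function.ne_iff.1 (hx h)) hr base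
        fun Y => acc (simulatedView eL eK eR Φ S A B x r σv σα σκ θ κS k Y)
    rw [e1, ← e2]
    refine abs_avg_pi_sub_le (fun k : K => Φ k) Ψ fun W p => ?_
    let γ : Fin m → Fin (N + 1) → L → L := fun h c z =>
      base h c + ∑ j, if x h j ≠ a j then (if j = p then z else W j (r h) c) else 0
    have e3 : ∀ U : R → Fin (N + 1) → L, Ψ (Function.update W p U) =
        acc (simulatedView eL eK eR Φ S A B x r σv σα σκ θ κS k fun h c => γ h c (U (r h) c)) := by
      intro U
      simp only [Ψ]
      congr 2
      funext h c
      simp only [γ, Pi.add_apply, Finset.sum_apply]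
      congr 1
      refine Finset.sum_congr rfl fun j _ => ?_
      by_cases hj : j = p
      · subst hj
        split_ifs <;> simp_all
      · rw [Function.update_of_ne hj]
        split_ifs <;> simp
    simp only [e3]
    exact hε (fun y => simulatedView eL eK eR Φ S A B x r σv σα σκ θ κS k fun h c =>
        γ h c (y h c)) (byFormulas_simulatedView ..) fun y => length_simulatedView_le ..

open Classical in
theorem abs_viewList_sub_le {acc : Adversary} {lam : ℕ} (eL : BitEncoding L) (eK : BitEncoding K)
    (eR : BitEncoding R) {Φ : K → R → Fin (N + 1) → L} (hΦ : IsKeyLinear 𝔽 Φ)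
    {ι : Fin (n + 1) → 𝔽} (hι : Function.Injective ι) (ht : 1 ≤ t) (htn : t ≤ n) (hℓ : 1 ≤ ℓ)
    {k₀ : Subfield 𝔽} (hK : ∃ κ : Fin n × Idx ℓ → K, LinearIndependent k₀ κ)
    {S : Finset (Fin n)} (hS : S ⊆ S') (hS' : S'.card + 1 = t) {A : Fin n → 𝔽}
    {B : Fin n → S' → 𝔽} (hAB : IsShareCoeffs ι t S' A B) {a : Fin ℓ → Bool} (α : L)
    {x : Fin m → Fin ℓ → Bool} (hx : ∀ h, x h ≠ a) {r : Fin m → R} (hr : Function.Injective r)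
    {ε : ℝ} (hε : ∀ g : (Fin m → Fin (N + 1) → L) → List Bool,
      ByFormulas eL (Form.tableSize eL.len) g →
      (∀ y, (g y).length ≤ n * keyBitsLength n ℓ N eL.len eK.len +
        n * (m * outBitsLength n N eL.len eK.len eR.len)) →
      |(avg fun k => acc.acc lam (g fun h => Φ k (r h))) -
        avg fun U : R → Fin (N + 1) → L => acc.acc lam (g fun h => U (r h))| ≤ ε) :
    |((((shamirGen (N := N) ht hℓ ι k₀ hK a α).map (viewList eL eK eR Φ S x r)).bind
        (acc.run lam noOracle)) true).toReal -
      avg fun θ => avg fun σv => avg fun σα =>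
        idealAcc (acc.acc lam) eL eK eR Φ S A B x r σv σα θ| ≤
    (avg fun κ : Fin n × Idx ℓ → K => if LinearIndependent k₀ κ then (0 : ℝ) else 1) +
      ℓ * ε := by
  have hκ : Nonempty {κ : Fin n × Idx ℓ → K // LinearIndependent k₀ κ} :=
    hK.elim fun κ hκ => ⟨⟨κ, hκ⟩⟩
  have hα := nonempty_splittings hℓ a α
  obtain ⟨i₀, hi₀⟩ : ∃ i₀, i₀ ∉ S' := by
    by_contra! h
    have : S' = Finset.univ := Finset.eq_univ_of_forall h
    rw [this, Finset.card_univ, Fintype.card_fin] at hS'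
    omega
  have e1 : (avg fun θ => avg fun σv => avg fun σα =>
        idealAcc (acc.acc lam) eL eK eR Φ S A B x r σv σα θ) =
      avg fun v => avg fun σv => avg fun _ : {αv : Idx ℓ → L // ∑ j, αv (j, a j) = α} =>
        avg fun σα => idealAcc (acc.acc lam) eL eK eR Φ S A B x r σv σα (selectVec a v) := by
    simp only [avg_const]
    exact (avg_addHom (selectVec a)
      (fun v w => by funext h; simp [selectVec, Finset.sum_add_distrib])
      (selectVec_surjective hℓ a) _).symm
  rw [e1, shamirGen_eq hι ht hℓ k₀ hK a α hS' hAB]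
  simp only [PMF.map_bind, PMF.pure_map, PMF.bind_bind, PMF.pure_bind, unif_bind_toReal,
    viewList_shareKey eL eK eR hΦ hS hAB.zero_of_mem]
  refine abs_avg_sub_le fun v => abs_avg_sub_le fun σv => abs_avg_sub_le fun αv =>
    abs_avg_sub_le fun σα => ?_
  exact abs_avg_view_sub_idealAcc_le (acc.acc_nonneg lam) (acc.acc_le_one lam) eL eK eR hΦ hℓ hi₀
    A B hx hr hε v σv αv.1 σα (selectVec a v)

end multiEval

theorem Negligible.max_zero {ε : ℕ → ℝ} (h : Negligible ε) :
    Negligible fun lam => max (ε lam) 0 := fun c => by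
  obtain ⟨N, hN⟩ := h c
  refine ⟨N, fun lam hlam => max_lt (hN lam hlam) ?_⟩
  have : (0 : ℝ) < lam := by exact_mod_cast (Nat.zero_le N).trans_lt hlam
  positivity

theorem exists_superset_card_add_one {n t : ℕ} (htn : t ≤ n) {S : Finset (Fin n)}
    (hS : S.card < t) : ∃ S', S ⊆ S' ∧ S'.card + 1 = t := by
  obtain ⟨S', h, hc⟩ := Finset.exists_superset_card_eq (s := S) (n := t - 1) (by omega)
    (by rw [Fintype.card_fin]; omega)
  exact ⟨S', h, by omega⟩

section

variable {n t ℓ N m : ℕ} {𝔽 L K R : Type} [Field 𝔽] [Field L] [Field K] [Algebra 𝔽 L]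
  [Algebra 𝔽 K] [Finite L] [Finite K]

theorem shamirGen_shares_eq_of_card_lt {ι : Fin (n + 1) → 𝔽} (hι : Function.Injective ι)
    (ht : 1 ≤ t) (htn : t ≤ n) (hℓ : 1 ≤ ℓ) (k₀ : Subfield 𝔽)
    (hK : ∃ κ : Fin n × Idx ℓ → K, LinearIndependent k₀ κ) (a b : Fin ℓ → Bool) (α β : L)
    {S : Finset (Fin n)} (hS : S.card < t) :
    ((shamirGen (N := N) ht hℓ ι k₀ hK a α).map fun f (i : S) => f i) =
      (shamirGen (N := N) ht hℓ ι k₀ hK b β).map fun f (i : S) => f i := by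
  obtain ⟨S', hS', hc⟩ := exists_superset_card_add_one htn hS
  have h := congrArg (PMF.map fun (f : S' → ShamirKey n ℓ N L K) (i : S) => f ⟨i, hS' i.2⟩)
    (shamirGen_shares_eq (N := N) hι ht htn hℓ k₀ hK a b α β hc)
  rwa [PMF.map_comp, PMF.map_comp] at h

/-- Without evaluations the view is determined by the key shares. -/
theorem map_viewList_eq_of_isEmpty [IsEmpty (Fin m)] (eL : BitEncoding L) (eK : BitEncoding K)
    (eR : BitEncoding R) (Φ : K → R → Fin (N + 1) → L) {ι : Fin (n + 1) → 𝔽}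
    (hι : Function.Injective ι) (ht : 1 ≤ t) (htn : t ≤ n) (hℓ : 1 ≤ ℓ) (k₀ : Subfield 𝔽)
    (hK : ∃ κ : Fin n × Idx ℓ → K, LinearIndependent k₀ κ) (a b : Fin ℓ → Bool) (α β : L)
    {S : Finset (Fin n)} (hS : S.card < t) (x : Fin m → Fin ℓ → Bool) (r : Fin m → R) :
    (shamirGen ht hℓ ι k₀ hK a α).map (viewList eL eK eR Φ S x r) =
      (shamirGen ht hℓ ι k₀ hK b β).map (viewList eL eK eR Φ S x r) := by
  classical
  have hv : viewList eL eK eR Φ S x r = (fun f : S → ShamirKey n ℓ N L K =>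
      ((List.finRange n).filter fun i => i ∈ S).flatMap fun i =>
        if h : i ∈ S then (f ⟨i, h⟩).bits eL eK else []) ∘ fun f i => f i := by
    funext f
    have h0 : ∀ i : Fin n, ((List.finRange m).flatMap fun h =>
        (shamirEval Φ (f i) (x h) (r h)).bits eL eK eR) = [] := fun i =>
      List.flatMap_eq_nil_iff.2 fun h => isEmptyElim h
    simp only [viewList, h0]
    rw [List.flatMap_eq_nil_iff.2 fun _ _ => rfl, List.append_nil, Function.comp_apply]
    refine List.flatMap_congr fun i hi => ?_
    have hi' : i ∈ S := by simpa using hi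
    rw [dif_pos hi']
  rw [hv, ← PMF.map_comp, ← PMF.map_comp,
    shamirGen_shares_eq_of_card_lt hι ht htn hℓ k₀ hK a b α β hS]

end

/-- The Shamir-based construction from an `𝔽`-key-homomorphic PRF family is a `t`-out-of-`n`
computational multi-evaluation DPF scheme for the point functions `{0,1}^ℓ → L`. -/
theorem mainTheorem1 {n t ℓ : ℕ} (ht : 1 ≤ t) (htn : t ≤ n) (hℓ : 1 ≤ ℓ)
    {𝔽 L : Type} [Field 𝔽] [Field L] [Finite L] [Algebra 𝔽 L]
    (ι : Fin (n + 1) → 𝔽) (hι : Function.Injective ι)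
    {K R : ℕ → Type} [∀ lam, Field (K lam)] [∀ lam, Finite (K lam)] [∀ lam, Algebra 𝔽 (K lam)]
    [∀ lam, Finite (R lam)]
    (eL : BitEncoding L) (eK : ∀ lam, BitEncoding (K lam)) (eR : ∀ lam, BitEncoding (R lam))
    (Φ : ∀ lam, K lam → R lam → Fin (2 * ℓ + lam + 1) → L)
    (hΦ : IsKeyHomomorphicPRF 𝔽 eL eK eR Φ)
    (k₀ : Subfield 𝔽) (hK : ∀ lam, ∃ κ : Fin n × Idx ℓ → K lam, LinearIndependent k₀ κ) :
    (shamirDPF (t := t) ht hℓ ι eL eK eR Φ k₀ hK).IsMultiEvalThresholdDPF := by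
  classical
  have hlin : ∀ lam, IsKeyLinear 𝔽 (Φ lam) := fun lam => ⟨hΦ.map_add lam, hΦ.map_smul lam⟩
  refine ⟨fun lam a α e r => ?_, ⟨_, negligible_one_div_two_pow, fun lam a α e x r hx => ?_⟩,
    fun lam a b α β S hS =>
      shamirGen_shares_eq_of_card_lt hι ht htn hℓ k₀ (hK lam) a b α β hS,
    fun a b α β S m x r hS hm hx hr => ⟨?_, fun D hD => ?_⟩⟩
  · have h := shamirRec_at ht hℓ hι k₀ (hK lam) (hlin lam) a α e r
    have h₁ : PMF.pure α α = 1 := by simp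
    exact (congrArg (fun p : PMF L => p α) h).trans h₁
  · refine lt_of_lt_of_le ?_
      (shamirRec_off ht hℓ hι k₀ (hK lam) (hlin lam) a α e x hx r)
    refine sub_lt_sub_left ?_ 1
    rw [Nat.card_fun, Nat.card_eq_fintype_card (α := Fin (2 * ℓ + lam)), Fintype.card_fin, one_div]
    have h2 : 2 ≤ Nat.card L := Finite.one_lt_card
    have h3 : (2 : ℝ) ^ lam < ((Nat.card L ^ (2 * ℓ + lam) : ℕ) : ℝ) := by
      exact_mod_cast (Nat.pow_lt_pow_right (by norm_num) (by omega)).trans_le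
        (Nat.pow_le_pow_left h2 _)
    exact inv_strictAnti₀ (by positivity) h3
  all_goals
    have hN : PolyBounded fun lam => 2 * ℓ + lam := (PolyBounded.const _).add PolyBounded.id
    have hB : PolyBounded fun lam =>
        n * keyBitsLength n ℓ (2 * ℓ + lam) eL.len (eK lam).len +
          n * (m lam * outBitsLength n (2 * ℓ + lam) eL.len (eK lam).len (eR lam).len) := by
      have c := PolyBounded.const
      have hk : PolyBounded fun lam => keyBitsLength n ℓ (2 * ℓ + lam) eL.len (eK lam).len :=
        ((((((c n).add ((c _).mul (hN.mul (c _)))).add (hN.mul (c _))).add (c _)).add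
          ((c _).mul hΦ.key_length)).add ((c n).mul ((c _).mul hΦ.key_length))).add hΦ.key_length
      have ho : PolyBounded fun lam =>
          outBitsLength n (2 * ℓ + lam) eL.len (eK lam).len (eR lam).len :=
        (((((c n).add (hN.mul (c _))).add (c _)).add hΦ.input_length).add
          (hN.mul (c _))).add hΦ.key_length
      exact ((c n).mul hk).add ((c n).mul (hm.mul ho))
  · refine ⟨fun lam =>
      ((List.finRange n).filter fun i => i ∈ S lam).length *
          keyBitsLength n ℓ (2 * ℓ + lam) eL.len (eK lam).len +
        n * (m lam * outBitsLength n (2 * ℓ + lam) eL.len (eK lam).len (eR lam).len),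
      hB.mono fun lam => ?_, fun lam => ⟨fun s hs => ?_, fun s hs => ?_⟩⟩
    · gcongr
      simpa using List.length_filter_le (fun i => decide (i ∈ S lam)) (List.finRange n)
    all_goals
      obtain ⟨f, -, rfl⟩ := (PMF.mem_support_map_iff _ _ _).1 hs
      exact length_viewList eL (eK lam) (eR lam) (Φ lam) (S lam) (x lam) (r lam) f
  · have hfin : Finite 𝔽 := Finite.of_injective _ (algebraMap 𝔽 L).injective
    obtain ⟨ε₁, hε₁, h₁⟩ := hΦ.secure.inv_card_le hΦ.input_length
      (hN.add (PolyBounded.const 1)) (fun lam => by omega) fun lam r => (hlin lam).map_zero r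
    obtain ⟨ε₂, hε₂, h₂⟩ := hΦ.secure.gap_le hΦ.input_length hD (hB.add hm)
      (Form.tableSize eL.len)
    have hε₂0 : ∀ lam, 0 ≤ ε₂ lam := fun lam =>
      (abs_nonneg _).trans (h₂ lam 0 Fin.elim0 (fun _ => []) (Nat.zero_le _)
        (ByFormulas.const (Form.one_le_tableSize _) []) fun _ => Nat.zero_le _)
    refine Negligible.mono (((hε₁.max_zero.const_mul
      (Nat.cast_nonneg (Nat.card (Fin n × Idx ℓ → k₀)))).add
      (hε₂.const_mul (Nat.cast_nonneg ℓ))).const_mul zero_le_two) fun lam => ?_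
    by_cases hR : Nonempty (R lam)
    · obtain ⟨S', hS', hc⟩ := exists_superset_card_add_one htn (hS lam)
      obtain ⟨A, B, hAB⟩ := exists_isShareCoeffs hι hc
      have hgap : ∀ g : (Fin (m lam) → Fin (2 * ℓ + lam + 1) → L) → List Bool,
          ByFormulas eL (Form.tableSize eL.len) g →
          (∀ y, (g y).length ≤ n * keyBitsLength n ℓ (2 * ℓ + lam) eL.len (eK lam).len +
            n * (m lam * outBitsLength n (2 * ℓ + lam) eL.len (eK lam).len (eR lam).len)) →
          |(avg fun k => D.acc lam (g fun h => Φ lam k (r lam h))) -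
            avg fun U : R lam → Fin (2 * ℓ + lam + 1) → L =>
              D.acc lam (g fun h => U (r lam h))| ≤ ε₂ lam := fun g hg hl =>
        h₂ lam (m lam) (r lam) g (Nat.le_add_left _ _) hg fun y =>
          (hl y).trans (Nat.le_add_right _ _)
      have hq : (avg fun κ : Fin n × Idx ℓ → K lam =>
          if LinearIndependent k₀ κ then (0 : ℝ) else 1) ≤
          Nat.card (Fin n × Idx ℓ → k₀) * max (ε₁ lam) 0 :=
        avg_not_linearIndependent_le.trans (mul_le_mul_of_nonneg_left
          ((h₁ lam hR).trans (le_max_left _ _)) (Nat.cast_nonneg _))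
      have ha := abs_viewList_sub_le (acc := D) (lam := lam) eL (eK lam) (eR lam) (hlin lam) hι ht
        htn hℓ (hK lam) hS' hc hAB (α lam) (fun h => (hx lam h).1) (hr lam) hgap
      have hb := abs_viewList_sub_le (acc := D) (lam := lam) eL (eK lam) (eR lam) (hlin lam) hι ht
        htn hℓ (hK lam) hS' hc hAB (β lam) (fun h => (hx lam h).2) (hr lam) hgap
      rw [abs_sub_comm] at hb
      refine (abs_sub_le _ _ _).trans ((add_le_add ha hb).trans ?_)
      linarith
    · have hR' : IsEmpty (R lam) := not_nonempty_iff.1 hR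
      have hm0 : IsEmpty (Fin (m lam)) := Function.isEmpty (r lam)
      have hv := map_viewList_eq_of_isEmpty eL (eK lam) (eR lam) (Φ lam) hι ht htn hℓ k₀ (hK lam)
        (a lam) (b lam) (α lam) (β lam) (hS lam) (x lam) (r lam)
      have hv' : (shamirDPF (t := t) ht hℓ ι eL eK eR Φ k₀ hK).view lam (a lam) (α lam) (S lam)
          (x lam) (r lam) = (shamirDPF (t := t) ht hℓ ι eL eK eR Φ k₀ hK).view lam (b lam) (β lam)
          (S lam) (x lam) (r lam) := hv
      simp only [hv', advantage, sub_self, abs_zero]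
      have := hε₂0 lam
      positivity
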